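/- Let $n,k\ge 0$ be integers, $x^0,x^1\in\mathbb R^n$, let $f,g_1,\dots,g_k:\mathbb R^n\to\mathbb R^n$ be locally Lipschitz, $G(x)u=\sum_i u_i g_i(x)$, and let $L:\mathbb R^n\times\mathbb R^k\to\mathbb R$ be continuous, with $u\mapsto L(x,u)$ convex for each $x$. Consider the Lagrange problem $$\int_0^1 L(x(t),u(t))\,dt\to\min,\qquad \dot x=f(x)+G(x)u,\quad x(0)=x^0,\quad x(1)=x^1 .$$ The auxiliary Lagrangian $\lambda:\mathbb R^n\times[0,\infty)\times\mathbb R^k\to(-\infty,+\infty]$ is $\lambda(y,v,w)=L(y,w/v)\,v$ for $v>0$ and $\lambda(y,0,w)=\lim_{\eta\to0^+}L(y,w/\eta)\,\eta$. Let $B_k^+=\{(v,w)\in\mathbb R^{1+k}: v\ge 0,\ v^2+|w|^2\le 1\}$. *Generalized controls.* Two (locally) absolutely continuous curves $\gamma_1,\gamma_2$ on $[0,\infty)$ are equivalent if $\inf_\alpha\|\gamma_1-\gamma_2\circ\alpha\|_{L_\infty}=0$, where $\alpha$ runs over the increasing absolutely continuous bijections of $[0,\infty)$ with absolutely continuous inverse;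 $[\gamma]$ is the equivalence class of $\gamma$. The set $\mathcal F^0_{k,1}$ of Fréchet generalized controls on $[0,1]$ consists of the classes $[(V,W)]$ of absolutely continuous curves $(V,W):[0,\infty)\to\mathbb R^{1+k}$ of infinite length with $V(0)=0$, $W(0)=0$, $\dot V\ge0$ a.e. and $\lim_{t\to\infty}V(t)>1$. Put $(v,w)=(\dot V,\dot W)$ and $V^\#(1)=\sup\{s\ge 0: V(s)\le 1\}$, let $y_{(v,w)}$ be the solution of $\dot y=f(y)v+G(y)w$, $y(0)=x^0$, and, when it exists on $[0,V^\#(1)]$, let $$I([(V,W)])=\int_0^{V^\#(1)}\lambda\big(y_{(v,w)},v,w\big)\,dt .$$ The endpoint $y_{(v,w)}(V^\#(1))$ and $I$ depend only on the class $[(V,W)]$. An ordinary control $u\in L_1^k[0,1]$ with trajectory $x_u$ starting at $x^0$ is identified with the class $[(t,U)]$, $U(t)=\int_0^t u$. The problem has a *Lavrentiev gap* if $$\lim_{\varepsilon\to0^+}\ \inf_{\substack{u\in L_1^k[0,1]\\ |x_u(1)-x^1|\le\varepsilon}} I([(t,U)])\ >\ \inf_{\substack{[(V,W)]\in\mathcal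 F^0_{k,1}\\ y_{(v,w)}(V^\#(1))=x^1}} I([(V,W)]),$$ the infima being taken in $[-\infty,+\infty]$ over the controls whose trajectories exist up to time $1$ (the infimum over the empty set is $+\infty$). **Proposition.** If $\lambda$ is continuous on $\mathbb R^n\times B_k^+$, then the problem has no Lavrentiev gap. **Corollary.** If $L(x,u)=L_1(x)+L_2(x,u)$ for all $(x,u)$, where $u\mapsto L_2(x,u)$ is positively homogeneous of degree $1$ for every $x$, then the problem has no Lavrentiev gap. -/

import Mathlib

open MeasureTheory Set Filter Topology
open scoped ENNReal

namespace LagrangeGap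

/-- Euclidean space `ℝᵐ`. -/
abbrev E (m : ℕ) := EuclideanSpace ℝ (Fin m)

/-! ### Absolutely continuous Fréchet curves

Curves are functions on `[0,+∞[`; they are written as functions on `ℝ`, of which only the values at
`t ≥ 0` are used. -/

/-- Absolute continuity on `[0,+∞[`, i.e. on each compact subinterval. -/
def ACHalfLine {X : Type*} [PseudoMetricSpace X] (g : ℝ → X) : Prop :=
  ∀ T : ℝ, 0 ≤ T → AbsolutelyContinuousOnInterval g 0 T

/-- The set `𝒯` of increasing absolutely continuous bijections of `[0,+∞[` with absolutely
continuous inverse. -/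
def reparametrizations : Set (ℝ → ℝ) :=
  {α | StrictMonoOn α (Ici 0) ∧ BijOn α (Ici 0) (Ici 0) ∧ ACHalfLine α ∧
    ∃ β : ℝ → ℝ, ACHalfLine β ∧ InvOn β α (Ici 0) (Ici 0)}

/-- Equivalence of parametrizations: `inf_{α ∈ 𝒯} ‖g₁ - g₂ ∘ α‖_{L∞[0,+∞[} = 0`. -/
def FrechetEquiv {X : Type*} [PseudoMetricSpace X] (g₁ g₂ : ℝ → X) : Prop :=
  ⨅ α ∈ reparametrizations, ⨆ t ∈ Ici (0 : ℝ), edist (g₁ t) (g₂ (α t)) = 0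

/-- The Fréchet curve `[g]`: the class of all absolutely continuous curves equivalent to `g`. -/
def frechetClass {X : Type*} [PseudoMetricSpace X] (g : ℝ → X) : Set (ℝ → X) :=
  {h | ACHalfLine h ∧ FrechetEquiv g h}

/-! ### Fréchet generalized controls

The maximum distance that `ℝ × E k` carries is equivalent to the Euclidean one of `ℝ^{1+k}`, hence
gives the same absolutely continuous curves and the same equivalence classes; lengths are computed
with the Euclidean norm. -/

/-- `v = dV/dt` for the parametrized curve `γ = (V, W)`. -/
noncomputable def vel {k : ℕ} (γ : ℝ → ℝ × E k) (t : ℝ) : ℝ := deriv (fun s => (γ s).1) t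

/-- `w = dW/dt` for the parametrized curve `γ = (V, W)`. -/
noncomputable def wel {k : ℕ} (γ : ℝ → ℝ × E k) (t : ℝ) : E k := deriv (fun s => (γ s).2) t

/-- The total Euclidean length of `γ = (V, W)` on `[0,+∞[`. -/
noncomputable def totalLength {k : ℕ} (γ : ℝ → ℝ × E k) : ℝ≥0∞ :=
  ∫⁻ t in Ici (0 : ℝ), ENNReal.ofReal (Real.sqrt (vel γ t ^ 2 + ‖wel γ t‖ ^ 2))

/-- The set `𝒴⁰_{k,T}` of absolutely continuous curves `(V, W)` of infinite length with `V(0) = 0`,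
`dV/dt ≥ 0` almost everywhere, `V(+∞) > T` and `W(0) = 0`. -/
def controlCurves (k : ℕ) (T : ℝ) : Set (ℝ → ℝ × E k) :=
  {γ | ACHalfLine γ ∧ (γ 0).1 = 0 ∧ (∀ᵐ t ∂(volume.restrict (Ici (0 : ℝ))), 0 ≤ vel γ t) ∧
    totalLength γ = ⊤ ∧ (∃ t : ℝ, 0 ≤ t ∧ T < (γ t).1) ∧ (γ 0).2 = 0}

/-- The space `𝓕⁰_{k,T}` of Fréchet generalized controls on `[0,T]`. -/
def generalizedControls (k : ℕ) (T : ℝ) : Set (Set (ℝ → ℝ × E k)) :=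
  {c | ∃ γ ∈ controlCurves k T, c = frechetClass γ}

/-- `V^#(T) = sup {s ≥ 0 : V(s) ≤ T}` for `γ = (V, W)`. -/
noncomputable def exitParam {k : ℕ} (γ : ℝ → ℝ × E k) (T : ℝ) : ℝ :=
  sSup {s : ℝ | 0 ≤ s ∧ (γ s).1 ≤ T}

/-- For an ordinary control `u ∈ L₁[0,1]` (continued by `0`), the curve `t ↦ (t, U(t))` with
`U(t) = ∫₀ᵗ u`. -/
noncomputable def ordinaryCurve {k : ℕ} (u : ℝ → E k) (t : ℝ) : ℝ × E k :=
  (t, ∫ s in (0 : ℝ)..t, (Icc (0 : ℝ) 1).indicator u s)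

/-! ### Trajectories -/

/-- `x` is the trajectory on `[0,1]` of `x' = f(x) + ∑ᵢ uᵢ gᵢ(x)`, `x(0) = x⁰`. -/
def IsOrdinaryTrajectory {n k : ℕ} (f : E n → E n) (g : Fin k → E n → E n) (x₀ : E n)
    (u : ℝ → E k) (x : ℝ → E n) : Prop :=
  AbsolutelyContinuousOnInterval x 0 1 ∧ x 0 = x₀ ∧
    ∀ᵐ t ∂(volume.restrict (Icc (0 : ℝ) 1)), HasDerivAt x (f (x t) + ∑ i, u t i • g i (x t)) t

/-- `y` is the trajectory `y_{(v,w)}` on `[0, V^#(1)]` of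
`y' = f(y) v + ∑ᵢ wᵢ gᵢ(y)`, `y(0) = x⁰`, where `γ = (V, W)`. -/
def IsGeneralizedTrajectory {n k : ℕ} (f : E n → E n) (g : Fin k → E n → E n) (x₀ : E n)
    (γ : ℝ → ℝ × E k) (y : ℝ → E n) : Prop :=
  AbsolutelyContinuousOnInterval y 0 (exitParam γ 1) ∧ y 0 = x₀ ∧
    ∀ᵐ t ∂(volume.restrict (Icc (0 : ℝ) (exitParam γ 1))),
      HasDerivAt y (vel γ t • f (y t) + ∑ i, wel γ t i • g i (y t)) t

/-! ### The auxiliary Lagrangian and the cost -/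

/-- The auxiliary Lagrangian `λ(y,v,w)`: it is `L(y, w/v) v` for `v > 0` and
`lim_{η → 0⁺} L(y, w/η) η` for `v = 0`. The limit may be `+∞`. Values at `v < 0` are not used. -/
noncomputable def auxLagrangian {n k : ℕ} (L : E n → E k → ℝ) (y : E n) (v : ℝ) (w : E k) : EReal :=
  if 0 < v then ((L y (v⁻¹ • w) * v : ℝ) : EReal)
  else limUnder (𝓝[>] (0 : ℝ)) fun η : ℝ => ((L y (η⁻¹ • w) * η : ℝ) : EReal)

/-- The set `B_k⁺ = {(v,w) : v ≥ 0, v² + |w|² ≤ 1}`. -/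
def halfBall (k : ℕ) : Set (ℝ × E k) := {p | 0 ≤ p.1 ∧ p.1 ^ 2 + ‖p.2‖ ^ 2 ≤ 1}

/-- The integral over `s` of an extended real function, as the difference of the integrals of its
positive and negative parts. -/
noncomputable def extIntegral (s : Set ℝ) (φ : ℝ → EReal) : EReal :=
  ((∫⁻ t in s, (φ t).toENNReal : ℝ≥0∞) : EReal) - ((∫⁻ t in s, (-φ t).toENNReal : ℝ≥0∞) : EReal)

/-- `∫₀^{V^#(1)} λ(y, v, w) dt` for `γ = (V, W)`. -/
noncomputable def curveCost {n k : ℕ} (L : E n → E k → ℝ) (γ : ℝ → ℝ × E k) (y : ℝ → E n) : EReal :=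
  extIntegral (Icc (0 : ℝ) (exitParam γ 1)) fun t => auxLagrangian L (y t) (vel γ t) (wel γ t)

/-- The graph of `[(V,W)] ↦ (y_{(v,w)} ∘ V^#(1), I([(V,W)]))`: the generalized control `c` steers
`x⁰` to `z` along its generalized trajectory, which exists up to time `1`, and has cost
`I(c) = r`. Endpoint and cost are computed along a representative `(V,W)` of `c`; they do not depend
on its choice. -/
def HasEndpointCost {n k : ℕ} (f : E n → E n) (g : Fin k → E n → E n) (L : E n → E k → ℝ)
    (x₀ : E n) (c : Set (ℝ → ℝ × E k)) (z : E n) (r : EReal) : Prop :=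
  ∃ γ ∈ controlCurves k 1, γ ∈ c ∧ ∃ y : ℝ → E n,
    IsGeneralizedTrajectory f g x₀ γ y ∧ y (exitParam γ 1) = z ∧ curveCost L γ y = r

/-! ### The Lavrentiev gap -/

/-- The infimum of `I([(t,U)])` over the ordinary controls `u ∈ L₁[0,1]` with
`|x_u(1) - x¹| ≤ ε`. -/
noncomputable def ordinaryInf {n k : ℕ} (f : E n → E n) (g : Fin k → E n → E n)
    (L : E n → E k → ℝ) (x₀ x₁ : E n) (ε : ℝ) : EReal :=
  sInf {r | ∃ u : ℝ → E k, IntegrableOn u (Icc (0 : ℝ) 1) ∧ ∃ x : ℝ → E n,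
    IsOrdinaryTrajectory f g x₀ u x ∧ ‖x 1 - x₁‖ ≤ ε ∧
    HasEndpointCost f g L x₀ (frechetClass (ordinaryCurve u)) (x 1) r}

/-- The infimum of `I([(V,W)])` over the Fréchet generalized controls with
`y_{(v,w)} ∘ V^#(1) = x¹`. -/
noncomputable def generalizedInf {n k : ℕ} (f : E n → E n) (g : Fin k → E n → E n)
    (L : E n → E k → ℝ) (x₀ x₁ : E n) : EReal :=
  sInf {r | ∃ c ∈ generalizedControls k 1, HasEndpointCost f g L x₀ c x₁ r}

/-- The `L₁^k[0,1]`-`𝓕⁰_{k,1}` Lavrentiev gap, with the boundary condition satisfied approximately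
by ordinary controls. -/
def HasLavrentievGap {n k : ℕ} (f : E n → E n) (g : Fin k → E n → E n)
    (L : E n → E k → ℝ) (x₀ x₁ : E n) : Prop :=
  generalizedInf f g L x₀ x₁ < limUnder (𝓝[>] (0 : ℝ)) (ordinaryInf f g L x₀ x₁)

end LagrangeGap

/-!
A generalized control `(V, W)` with trajectory `y` is approximated by ordinary controls, in endpoint
and in cost, by adding a small constant rate to its clock, which may otherwise stop.

Let `S` be the parameter at which `V` leaves `1`, and `v = V'`, `w = W'`. The rate
`v_δ = (v + δ) / (1 + δ S)` again has integral `1` over `[0, S]`, and it is bounded below by a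
positive constant. Picard iteration started at `y` converges to a solution `z_δ` of
`z' = v_δ f(z) + ∑ᵢ wᵢ gᵢ(z)` on `[0, S]` with `‖z_δ - y‖ = O(δ)` (`exists_solution_near`,
`exists_trajectory_perturbed_clock`). Starting from the approximate solution `y` gives existence and
continuous dependence in one step, and keeps the iterates in a ball where `f` and `gᵢ` are Lipschitz.
The clock `t = ∫ v_δ` has a Lipschitz inverse, so `z_δ` can be written in ordinary time, where it is
the trajectory of the ordinary control `w / v_δ`, with cost `∫ λ(z_δ, v_δ, w)`
(`exists_ordinary_control`).

If `λ` is continuous on the half ball, then its value `0` at `(y, 0, 0)` and homogeneity make it real,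
continuous for `v ≥ 0`, and of linear growth in `(v, w)` (`exists_real_auxLagrangian`). Dominated
convergence then gives `∫ λ(z_δ, v_δ, w) → ∫ λ(y, v, w)` as `δ → 0`
(`exists_ordinary_approximation`). A Lagrangian `L₁(x) + L₂(x, u)` with `L₂` positively homogeneous
in `u` has `λ = L₁ v + L₂(y, w)`, which is continuous
(`continuousOn_auxLagrangian_of_homogeneous`).
-/

namespace LagrangeGap

/-! ### Absolutely continuous curves -/

section AbsolutelyContinuous

variable {F : Type*} [NormedAddCommGroup F]

/-- A curve whose increments are dominated by those of an absolutely continuous curve is absolutely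
continuous. -/
lemma absolutelyContinuousOnInterval_of_dist_le {X Y : Type*} [PseudoMetricSpace X]
    [PseudoMetricSpace Y] {p : ℝ → X} {q : ℝ → Y} {a b : ℝ} (K : ℝ)
    (hq : AbsolutelyContinuousOnInterval q a b)
    (h : ∀ s ∈ uIcc a b, ∀ t ∈ uIcc a b, dist (p s) (p t) ≤ K * dist (q s) (q t)) :
    AbsolutelyContinuousOnInterval p a b := by
  have hK : Tendsto (fun E : ℕ × (ℕ → ℝ × ℝ) ↦
      K * ∑ i ∈ Finset.range E.1, dist (q (E.2 i).1) (q (E.2 i).2))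
      (AbsolutelyContinuousOnInterval.totalLengthFilter ⊓
        𝓟 (AbsolutelyContinuousOnInterval.disjWithin a b)) (𝓝 0) := by
    simpa using Tendsto.const_mul K hq
  refine squeeze_zero' ?_ ?_ hK
  · exact Eventually.of_forall fun E => Finset.sum_nonneg fun _ _ => dist_nonneg
  · have : ∀ᶠ E in AbsolutelyContinuousOnInterval.totalLengthFilter ⊓
        𝓟 (AbsolutelyContinuousOnInterval.disjWithin a b),
        E ∈ AbsolutelyContinuousOnInterval.disjWithin a b :=
      eventually_inf_principal.mpr (by simp)
    filter_upwards [this] with E hE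
    rw [Finset.mul_sum]
    refine Finset.sum_le_sum fun i hi => ?_
    exact h _ (hE.1 i hi).1 _ (hE.1 i hi).2

/-- Absolute continuity is preserved by a monotone Lipschitz change of parameter. -/
lemma absolutelyContinuousOnInterval_comp_monotone {X : Type*} [PseudoMetricSpace X]
    {p : ℝ → X} {β : ℝ → ℝ} {a b c d : ℝ} {K : ℝ}
    (hp : AbsolutelyContinuousOnInterval p c d) (hβ : Monotone β)
    (hK : ∀ s t, dist (β s) (β t) ≤ K * dist s t) (hmap : MapsTo β (uIcc a b) (uIcc c d)) :
    AbsolutelyContinuousOnInterval (p ∘ β) a b := by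
  rw [absolutelyContinuousOnInterval_iff] at hp ⊢
  intro ε hε
  obtain ⟨δ, hδ, H⟩ := hp ε hε
  have hK0 : 0 ≤ K := by
    have := (dist_nonneg).trans (hK 0 1)
    simpa using this
  refine ⟨δ / (K + 1), by positivity, fun I hI hsum => ?_⟩
  refine H (I.1, fun i => (β (I.2 i).1, β (I.2 i).2)) ⟨fun i hi => ?_, fun i hi j hj hij => ?_⟩ ?_
  · exact ⟨hmap (hI.1 i hi).1, hmap (hI.1 i hi).2⟩
  · have hd : Disjoint (uIoc (I.2 i).1 (I.2 i).2) (uIoc (I.2 j).1 (I.2 j).2) := hI.2 hi hj hij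
    rw [Function.onFun]
    simp only [uIoc, Ioc_disjoint_Ioc, ← hβ.map_max, ← hβ.map_min] at hd ⊢
    exact hβ hd
  · calc ∑ i ∈ Finset.range I.1, dist (β (I.2 i).1) (β (I.2 i).2)
        ≤ ∑ i ∈ Finset.range I.1, K * dist (I.2 i).1 (I.2 i).2 :=
          Finset.sum_le_sum fun i _ => hK _ _
      _ = K * ∑ i ∈ Finset.range I.1, dist (I.2 i).1 (I.2 i).2 := by rw [Finset.mul_sum]
      _ ≤ (K + 1) * ∑ i ∈ Finset.range I.1, dist (I.2 i).1 (I.2 i).2 :=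
          mul_le_mul_of_nonneg_right (by linarith) (Finset.sum_nonneg fun _ _ => dist_nonneg)
      _ < (K + 1) * (δ / (K + 1)) := by gcongr
      _ = δ := by field_simp

variable [NormedSpace ℝ F]

/-- An indefinite Bochner integral is absolutely continuous. -/
lemma absolutelyContinuousOnInterval_integral {h : ℝ → F} {a b : ℝ}
    (hh : IntervalIntegrable h volume a b) :
    AbsolutelyContinuousOnInterval (fun t => ∫ s in a..t, h s) a b := by
  refine absolutelyContinuousOnInterval_of_dist_le 1
    (hh.norm.absolutelyContinuousOnInterval_intervalIntegral left_mem_uIcc) fun s hs t ht => ?_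
  have hi : ∀ c ∈ uIcc a b, IntervalIntegrable h volume a c := fun c hc =>
    hh.mono_set (uIcc_subset_uIcc left_mem_uIcc hc)
  rw [one_mul, dist_eq_norm, Real.dist_eq, intervalIntegral.integral_interval_sub_left (hi s hs)
    (hi t ht), intervalIntegral.integral_interval_sub_left (hi s hs).norm (hi t ht).norm]
  exact intervalIntegral.norm_integral_le_abs_integral_norm

/-- The fundamental theorem of calculus for absolutely continuous curves in a Banach space that are
differentiable almost everywhere. -/
lemma eq_add_integral_of_ae_hasDerivAt [CompleteSpace F] {y h : ℝ → F} {a b : ℝ}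
    (hy : AbsolutelyContinuousOnInterval y a b) (hh : IntervalIntegrable h volume a b)
    (hd : ∀ᵐ t, t ∈ uIcc a b → HasDerivAt y (h t) t) {t : ℝ} (ht : t ∈ uIcc a b) :
    y t = y a + ∫ s in a..t, h s := by
  obtain ⟨C, hC⟩ := AbsolutelyContinuousOnInterval.const_of_ae_hasDerivAt_zero
    (hy.fun_sub (absolutelyContinuousOnInterval_integral hh)) (by
      filter_upwards [hd, hh.ae_hasDerivAt_integral] with s h1 h2 hs
      simpa using (h1 hs).fun_sub (h2 hs a left_mem_uIcc))
  have h1 := hC t ht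
  have h2 := hC a left_mem_uIcc
  simp only [intervalIntegral.integral_same, sub_zero] at h2
  rw [h2, ← h1]; abel

/-- An absolutely continuous curve in Euclidean space is differentiable almost everywhere and its
derivative is integrable. -/
lemma ae_differentiableAt_and_intervalIntegrable_deriv {m : ℕ} {p : ℝ → E m} {a b : ℝ}
    (hp : AbsolutelyContinuousOnInterval p a b) :
    (∀ᵐ t, t ∈ uIcc a b → DifferentiableAt ℝ p t) ∧ IntervalIntegrable (deriv p) volume a b := by
  have hc : ∀ i, AbsolutelyContinuousOnInterval (fun t => p t i) a b := fun i =>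
    absolutelyContinuousOnInterval_of_dist_le 1 hp fun s _ t _ => by
      rw [one_mul, dist_eq_norm, dist_eq_norm]
      exact PiLp.norm_apply_le (p s - p t) i
  have hd : ∀ᵐ t, t ∈ uIcc a b → DifferentiableAt ℝ p t := by
    filter_upwards [ae_all_iff.2 fun i => (hc i).ae_differentiableAt] with t ht htab
    exact differentiableAt_euclidean.2 fun i => ht i htab
  refine ⟨hd, ?_⟩
  have hsum : IntervalIntegrable (fun t => ∑ i, |deriv (fun s => p s i) t|) volume a b := by
    simpa only [Finset.sum_fn, Real.norm_eq_abs] using! IntervalIntegrable.sum Finset.univ fun i _ =>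
      (hc i).intervalIntegrable_deriv.norm
  refine hsum.mono_fun (stronglyMeasurable_deriv p).aestronglyMeasurable ?_
  rw [EventuallyLE, ae_restrict_iff' measurableSet_uIoc]
  filter_upwards [hd] with t ht htab
  have h1 := (ht (uIoc_subset_uIcc htab)).hasDerivAt
  have h2 : ∀ i, deriv (fun s => p s i) t = (deriv p t) i := fun i =>
    (((EuclideanSpace.proj i : E m →L[ℝ] ℝ).hasFDerivAt).comp_hasDerivAt t h1).deriv
  simp only [h2]
  refine le_trans ?_ (le_abs_self _)
  conv_lhs => rw [← (EuclideanSpace.basisFun (Fin m) ℝ).sum_repr (deriv p t)]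
  refine (norm_sum_le _ _).trans (Finset.sum_le_sum fun i _ => ?_)
  simp [norm_smul]

end AbsolutelyContinuous

/-! ### Carathéodory equations: solutions near an approximate solution -/

/-- The weight `e^{2∫m}`, for which integration against `m` is a contraction by `1/2`. -/
lemma integral_mul_exp_le {m : ℝ → ℝ} {S t : ℝ} (hm : IntervalIntegrable m volume 0 S)
    (ht : t ∈ Icc (0 : ℝ) S) :
    IntervalIntegrable (fun s => m s * Real.exp (2 * ∫ r in (0 : ℝ)..s, m r)) volume 0 t ∧
    ∫ s in (0 : ℝ)..t, m s * Real.exp (2 * ∫ r in (0 : ℝ)..s, m r) ≤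
      Real.exp (2 * ∫ r in (0 : ℝ)..t, m r) / 2 := by
  have htu : t ∈ uIcc (0 : ℝ) S := by rwa [uIcc_of_le (ht.1.trans ht.2)]
  have hmt : IntervalIntegrable m volume 0 t := hm.mono_set (uIcc_subset_uIcc left_mem_uIcc htu)
  have hac := hmt.absolutelyContinuousOnInterval_intervalIntegral (c := 0) left_mem_uIcc
  have hI : IntervalIntegrable (fun s => m s * Real.exp (2 * ∫ r in (0 : ℝ)..s, m r))
      volume 0 t := hmt.mul_continuousOn (by
        have := hac.continuousOn
        fun_prop)
  refine ⟨hI, ?_⟩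
  have hexp : AbsolutelyContinuousOnInterval
      (fun s => Real.exp (2 * ∫ r in (0 : ℝ)..s, m r)) 0 t := by
    obtain ⟨C, hC⟩ := hac.exists_bound
    obtain ⟨K, hK⟩ := LocallyLipschitzOn.exists_lipschitzOnWith_of_compact
      (isCompact_Icc (a := -C) (b := C))
      ((Real.contDiff_exp.comp (contDiff_const.mul contDiff_id :
        ContDiff ℝ 1 fun x : ℝ => 2 * x)).locallyLipschitz.locallyLipschitzOn (s := Icc (-C) C))
    refine absolutelyContinuousOnInterval_of_dist_le (K : ℝ) hac fun a ha b hb => ?_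
    exact hK.dist_le_mul _ (abs_le.1 (hC a ha)) _ (abs_le.1 (hC b hb))
  have hftc := eq_add_integral_of_ae_hasDerivAt hexp (hI.const_mul 2) (by
    filter_upwards [hmt.ae_hasDerivAt_integral] with s hs hsu
    have := ((hs hsu 0 left_mem_uIcc).const_mul 2).exp
    exact this.congr_deriv (by ring)) right_mem_uIcc
  rw [intervalIntegral.integral_const_mul] at hftc
  simp only [intervalIntegral.integral_same, mul_zero, Real.exp_zero] at hftc
  linarith

section Caratheodory

variable {F : Type*} [NormedAddCommGroup F] [NormedSpace ℝ F]

/-- The integral operator of a Carathéodory equation halves distances in the weighted norm. -/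
lemma norm_integral_sub_integral_le {S ρ D : ℝ} {Φ : ℝ → F → F} {m : ℝ → ℝ} {y a b : ℝ → F}
    (hm : IntervalIntegrable m volume 0 S) (hm0 : ∀ s, 0 ≤ m s)
    (hlip : ∀ s ∈ Icc (0 : ℝ) S, ∀ p q, ‖p - y s‖ ≤ ρ → ‖q - y s‖ ≤ ρ →
      ‖Φ s p - Φ s q‖ ≤ m s * ‖p - q‖)
    (ha : IntervalIntegrable (fun s => Φ s (a s)) volume 0 S)
    (hb : IntervalIntegrable (fun s => Φ s (b s)) volume 0 S)
    (hay : ∀ s ∈ Icc (0 : ℝ) S, ‖a s - y s‖ ≤ ρ) (hby : ∀ s ∈ Icc (0 : ℝ) S, ‖b s - y s‖ ≤ ρ)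
    (hab : ∀ s ∈ Icc (0 : ℝ) S, ‖a s - b s‖ ≤ D * Real.exp (2 * ∫ r in (0 : ℝ)..s, m r))
    (hD : 0 ≤ D) {t : ℝ} (ht : t ∈ Icc (0 : ℝ) S) :
    ‖(∫ s in (0 : ℝ)..t, Φ s (a s)) - ∫ s in (0 : ℝ)..t, Φ s (b s)‖ ≤
      D * Real.exp (2 * ∫ r in (0 : ℝ)..t, m r) / 2 := by
  have hsub : uIcc (0 : ℝ) t ⊆ uIcc 0 S := by
    rw [uIcc_of_le ht.1, uIcc_of_le (ht.1.trans ht.2)]; exact Icc_subset_Icc_right ht.2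
  obtain ⟨hI, hle⟩ := integral_mul_exp_le hm ht
  rw [← intervalIntegral.integral_sub (ha.mono_set hsub) (hb.mono_set hsub)]
  calc ‖∫ s in (0 : ℝ)..t, (Φ s (a s) - Φ s (b s))‖
      ≤ ∫ s in (0 : ℝ)..t, D * (m s * Real.exp (2 * ∫ r in (0 : ℝ)..s, m r)) := by
        refine intervalIntegral.norm_integral_le_of_norm_le ht.1 ?_ (hI.const_mul D)
        refine Eventually.of_forall fun s hs => ?_
        have hs' : s ∈ Icc (0 : ℝ) S := ⟨hs.1.le, hs.2.trans ht.2⟩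
        calc _ ≤ m s * ‖a s - b s‖ := hlip s hs' _ _ (hay s hs') (hby s hs')
          _ ≤ m s * (D * Real.exp (2 * ∫ r in (0 : ℝ)..s, m r)) :=
            mul_le_mul_of_nonneg_left (hab s hs') (hm0 s)
          _ = _ := by ring
    _ = D * ∫ s in (0 : ℝ)..t, m s * Real.exp (2 * ∫ r in (0 : ℝ)..s, m r) :=
        intervalIntegral.integral_const_mul _ _
    _ ≤ D * (Real.exp (2 * ∫ r in (0 : ℝ)..t, m r) / 2) := mul_le_mul_of_nonneg_left hle hD
    _ = _ := by ring

/-- If `y` solves the integral equation `y = x₀ + ∫ Φ(s, y)` up to an error `η` and `Φ` is Lipschitz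
with an integrable constant near the graph of `y`, then the Picard iterates started at `y` converge
to a solution whose distance from `y` is at most a multiple of `η`. This gives existence and
continuous dependence in one step. -/
theorem exists_solution_near [CompleteSpace F] {S η ρ : ℝ} {Φ : ℝ → F → F} {m : ℝ → ℝ}
    {y : ℝ → F} {x₀ : F} (hS : 0 ≤ S)
    (hm : IntervalIntegrable m volume 0 S) (hm0 : ∀ s, 0 ≤ m s)
    (hy : ContinuousOn y (Icc 0 S))
    (hint : ∀ z : ℝ → F, ContinuousOn z (Icc 0 S) →
      IntervalIntegrable (fun s => Φ s (z s)) volume 0 S)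
    (hlip : ∀ s ∈ Icc (0 : ℝ) S, ∀ p q, ‖p - y s‖ ≤ ρ → ‖q - y s‖ ≤ ρ →
      ‖Φ s p - Φ s q‖ ≤ m s * ‖p - q‖)
    (hη : 0 ≤ η)
    (hdef : ∀ t ∈ Icc (0 : ℝ) S, ‖x₀ + (∫ s in (0 : ℝ)..t, Φ s (y s)) - y t‖ ≤ η)
    (hsmall : 2 * η * Real.exp (2 * ∫ r in (0 : ℝ)..S, m r) ≤ ρ) :
    ∃ z : ℝ → F, ContinuousOn z (Icc 0 S) ∧
      (∀ t ∈ Icc (0 : ℝ) S, z t = x₀ + ∫ s in (0 : ℝ)..t, Φ s (z s)) ∧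
      ∀ t ∈ Icc (0 : ℝ) S, ‖z t - y t‖ ≤ 2 * η * Real.exp (2 * ∫ r in (0 : ℝ)..S, m r) := by
  set φ : ℝ → ℝ := fun t => Real.exp (2 * ∫ r in (0 : ℝ)..t, m r) with hφ
  have hφS : ∀ t ∈ Icc (0 : ℝ) S, φ t ≤ φ S := fun t ht => by
    refine Real.exp_le_exp.2 (mul_le_mul_of_nonneg_left ?_ zero_le_two)
    exact intervalIntegral.integral_mono_interval le_rfl ht.1 ht.2
      (Eventually.of_forall hm0) hm
  have hφ1 : ∀ t ∈ Icc (0 : ℝ) S, 1 ≤ φ t := fun t ht =>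
    Real.one_le_exp (mul_nonneg zero_le_two
      (intervalIntegral.integral_nonneg ht.1 fun s _ => hm0 s))
  have hφpos : ∀ t, 0 < φ t := fun t => Real.exp_pos _
  set Z : ℕ → ℝ → F := fun j => (fun (z : ℝ → F) t => x₀ + ∫ s in (0 : ℝ)..t, Φ s (z s))^[j] y
    with hZ
  have hZs : ∀ j t, Z (j + 1) t = x₀ + ∫ s in (0 : ℝ)..t, Φ s (Z j s) := fun j t => by
    simp only [hZ, Function.iterate_succ_apply']
  have hcont : ∀ z : ℝ → F, ContinuousOn z (Icc 0 S) →
      ContinuousOn (fun t => x₀ + ∫ s in (0 : ℝ)..t, Φ s (z s)) (Icc 0 S) := fun z hz => by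
    have := (absolutelyContinuousOnInterval_integral (hint z hz)).continuousOn
    rw [uIcc_of_le hS] at this
    exact continuousOn_const.add this
  have hnear : ∀ j, (∀ t ∈ Icc (0 : ℝ) S, ‖Z j t - y t‖ ≤ 2 * η * φ t * (1 - (1 / 2) ^ j)) →
      ∀ t ∈ Icc (0 : ℝ) S, ‖Z j t - y t‖ ≤ ρ := fun j hj t ht => by
    refine (hj t ht).trans (le_trans ?_ hsmall)
    have h0 : (0 : ℝ) ≤ (1 / 2) ^ j := by positivity
    calc 2 * η * φ t * (1 - (1 / 2) ^ j) ≤ 2 * η * φ t * 1 :=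
          mul_le_mul_of_nonneg_left (by linarith) (by have := hφpos t; positivity)
      _ ≤ 2 * η * φ S := by
          rw [mul_one]; exact mul_le_mul_of_nonneg_left (hφS t ht) (by positivity)
  have key : ∀ j, ContinuousOn (Z j) (Icc 0 S) ∧
      (∀ t ∈ Icc (0 : ℝ) S, ‖Z j t - y t‖ ≤ 2 * η * φ t * (1 - (1 / 2) ^ j)) ∧
      ∀ t ∈ Icc (0 : ℝ) S, ‖Z (j + 1) t - Z j t‖ ≤ η * (1 / 2) ^ j * φ t := by
    intro j
    induction j with
    | zero =>
      refine ⟨hy, fun t _ => by simp [hZ], fun t ht => ?_⟩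
      rw [hZs]
      simp only [pow_zero, mul_one]
      exact (hdef t ht).trans (le_mul_of_one_le_right hη (hφ1 t ht))
    | succ j ih =>
      obtain ⟨h1, h2, h3⟩ := ih
      have c2 : ContinuousOn (Z (j + 1)) (Icc 0 S) := by
        rw [show Z (j + 1) = fun t => x₀ + ∫ s in (0 : ℝ)..t, Φ s (Z j s) from funext (hZs j)]
        exact hcont _ h1
      have n2 : ∀ t ∈ Icc (0 : ℝ) S,
          ‖Z (j + 1) t - y t‖ ≤ 2 * η * φ t * (1 - (1 / 2) ^ (j + 1)) := fun t ht => by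
        calc ‖Z (j + 1) t - y t‖ ≤ ‖Z (j + 1) t - Z j t‖ + ‖Z j t - y t‖ :=
              norm_sub_le_norm_sub_add_norm_sub _ _ _
          _ ≤ η * (1 / 2) ^ j * φ t + 2 * η * φ t * (1 - (1 / 2) ^ j) :=
              add_le_add (h3 t ht) (h2 t ht)
          _ = _ := by rw [pow_succ]; ring
      refine ⟨c2, n2, fun t ht => ?_⟩
      rw [hZs (j + 1), hZs j, add_sub_add_left_eq_sub]
      refine (norm_integral_sub_integral_le hm hm0 hlip (hint _ c2) (hint _ h1)
        (hnear _ n2) (hnear _ h2) h3 (by positivity) ht).trans_eq ?_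
      simp only [hφ]; rw [pow_succ]; ring
  have hgeo : ∀ t ∈ Icc (0 : ℝ) S, ∀ j, dist (Z j t) (Z (j + 1) t) ≤ η * φ t * (1 / 2) ^ j :=
    fun t ht j => by
      rw [dist_comm, dist_eq_norm]
      exact ((key j).2.2 t ht).trans_eq (by ring)
  have hlim : ∀ t, ∃ a, t ∈ Icc (0 : ℝ) S → Tendsto (fun j => Z j t) atTop (𝓝 a) := fun t => by
    by_cases ht : t ∈ Icc (0 : ℝ) S
    · obtain ⟨a, ha⟩ := cauchySeq_tendsto_of_complete
        (cauchySeq_of_le_geometric _ _ (by norm_num) (hgeo t ht))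
      exact ⟨a, fun _ => ha⟩
    · exact ⟨0, fun h => absurd h ht⟩
  choose z hz using hlim
  have hdist : ∀ t ∈ Icc (0 : ℝ) S, ∀ j, ‖Z j t - z t‖ ≤ 2 * η * (1 / 2) ^ j * φ t :=
    fun t ht j => by
      rw [← dist_eq_norm]
      refine (dist_le_of_le_geometric_of_tendsto _ _ (by norm_num) (hgeo t ht) (hz t ht)
        j).trans_eq ?_
      ring
  have hpow : Tendsto (fun j : ℕ => 2 * η * (1 / 2) ^ j * φ S) atTop (𝓝 0) := by
    simpa using ((tendsto_pow_atTop_nhds_zero_of_lt_one (r := (1 / 2 : ℝ)) (by norm_num)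
      (by norm_num)).const_mul (2 * η)).mul_const (φ S)
  have hunif : TendstoUniformlyOn Z z atTop (Icc 0 S) := by
    rw [Metric.tendstoUniformlyOn_iff]
    intro ε hε
    filter_upwards [hpow.eventually (gt_mem_nhds hε)] with j hj t ht
    rw [dist_comm, dist_eq_norm]
    refine (hdist t ht j).trans_lt (lt_of_le_of_lt ?_ hj)
    exact mul_le_mul_of_nonneg_left (hφS t ht) (by positivity)
  have hzc : ContinuousOn z (Icc 0 S) :=
    hunif.continuousOn (Frequently.of_forall fun j => (key j).1)
  have hzy : ∀ t ∈ Icc (0 : ℝ) S, ‖z t - y t‖ ≤ 2 * η * φ S := fun t ht => by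
    have h0 := hdist t ht 0
    have : Z 0 t = y t := rfl
    rw [this, norm_sub_rev] at h0
    refine h0.trans ?_
    rw [pow_zero, mul_one]
    exact mul_le_mul_of_nonneg_left (hφS t ht) (by positivity)
  refine ⟨z, hzc, fun t ht => ?_, hzy⟩
  have hT : Tendsto (fun j => Z (j + 1) t) atTop (𝓝 (x₀ + ∫ s in (0 : ℝ)..t, Φ s (z s))) := by
    rw [tendsto_iff_norm_sub_tendsto_zero]
    refine squeeze_zero (fun _ => norm_nonneg _) (fun j => ?_) hpow
    rw [hZs, add_sub_add_left_eq_sub]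
    refine (norm_integral_sub_integral_le hm hm0 hlip (hint _ (key j).1) (hint _ hzc)
      (hnear j (key j).2.1) (fun s hs => (hzy s hs).trans hsmall) (fun s hs => hdist s hs j)
      (by positivity) ht).trans ?_
    have h1 : 2 * η * (1 / 2) ^ j * φ t ≤ 2 * η * (1 / 2) ^ j * φ S :=
      mul_le_mul_of_nonneg_left (hφS t ht) (by positivity)
    have h2 : 0 ≤ 2 * η * (1 / 2) ^ j * φ t := by have := hφpos t; positivity
    simp only [hφ] at h1 h2 ⊢
    linarith
  exact tendsto_nhds_unique ((hz t ht).comp (tendsto_add_atTop_nat 1)) hT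

end Caratheodory

/-! ### Ordinary controls as generalized controls -/

/-- For a real integrable function the extended integral is the Bochner integral. -/
lemma extIntegral_eq_integral {s : Set ℝ} {φ : ℝ → EReal} {ψ : ℝ → ℝ} (hψ : IntegrableOn ψ s)
    (h : ∀ᵐ t ∂(volume.restrict s), φ t = (ψ t : EReal)) :
    extIntegral s φ = ((∫ t in s, ψ t : ℝ) : EReal) := by
  have h1 : ∫⁻ t in s, (φ t).toENNReal = ∫⁻ t in s, ENNReal.ofReal (ψ t) :=
    lintegral_congr_ae (h.mono fun t ht => by simp [ht])
  have h2 : ∫⁻ t in s, (-φ t).toENNReal = ∫⁻ t in s, ENNReal.ofReal (-ψ t) :=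
    lintegral_congr_ae (h.mono fun t ht => by
      simp only [ht, ← EReal.coe_neg, EReal.toENNReal_of_ne_top (EReal.coe_ne_top _),
        EReal.toReal_coe])
  have f1 : ∫⁻ t in s, ENNReal.ofReal (ψ t) ≠ ⊤ := (Integrable.lintegral_lt_top hψ).ne
  have f2 : ∫⁻ t in s, ENNReal.ofReal (-ψ t) ≠ ⊤ := (Integrable.lintegral_lt_top hψ.neg).ne
  rw [extIntegral, h1, h2, integral_eq_lintegral_pos_part_sub_lintegral_neg_part hψ,
    EReal.coe_sub, EReal.coe_ennreal_toReal f1, EReal.coe_ennreal_toReal f2]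

lemma mem_frechetClass_self {X : Type*} [PseudoMetricSpace X] {γ : ℝ → X} (hγ : ACHalfLine γ) :
    γ ∈ frechetClass γ := by
  refine ⟨hγ, le_antisymm ?_ bot_le⟩
  have hid : ACHalfLine (id : ℝ → ℝ) := fun T _ =>
    (LipschitzWith.id.lipschitzOnWith).absolutelyContinuousOnInterval
  have : (id : ℝ → ℝ) ∈ reparametrizations :=
    ⟨strictMono_id.strictMonoOn _, bijOn_id _, hid, id, hid, fun _ _ => rfl, fun _ _ => rfl⟩
  refine (iInf₂_le id this).trans ?_
  simp

section OrdinaryCurve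

variable {k : ℕ} {u : ℝ → E k}

lemma integrable_indicator_control (hu : IntegrableOn u (Icc (0 : ℝ) 1)) :
    Integrable ((Icc (0 : ℝ) 1).indicator u) :=
  (integrable_indicator_iff measurableSet_Icc).2 hu

lemma acHalfLine_ordinaryCurve (hu : IntegrableOn u (Icc (0 : ℝ) 1)) :
    ACHalfLine (ordinaryCurve u) := by
  intro T _
  have hU := integrable_indicator_control hu
  have hi : ∀ a b, IntervalIntegrable (fun s => 1 + ‖(Icc (0 : ℝ) 1).indicator u s‖) volume a b :=
    fun a b => intervalIntegrable_const.add hU.norm.intervalIntegrable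
  refine absolutelyContinuousOnInterval_of_dist_le 1
    (absolutelyContinuousOnInterval_integral (hi 0 T)) fun s _ t _ => ?_
  rw [one_mul, dist_comm, dist_comm (∫ r in (0 : ℝ)..s, _), Real.dist_eq,
    intervalIntegral.integral_interval_sub_left (hi _ _) (hi _ _), Prod.dist_eq]
  refine max_le ?_ ?_
  · have : dist (ordinaryCurve u t).1 (ordinaryCurve u s).1 = ‖∫ _ in s..t, (1 : ℝ)‖ := by
      simp [ordinaryCurve, Real.dist_eq]
    rw [this]
    exact intervalIntegral.norm_integral_le_abs_of_norm_le
      (Eventually.of_forall fun r => by simp) (hi _ _)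
  · simp only [ordinaryCurve]
    rw [dist_eq_norm, intervalIntegral.integral_interval_sub_left hU.intervalIntegrable
      hU.intervalIntegrable]
    exact intervalIntegral.norm_integral_le_abs_of_norm_le
      (Eventually.of_forall fun r => by simp) (hi _ _)

lemma vel_ordinaryCurve (u : ℝ → E k) (t : ℝ) : vel (ordinaryCurve u) t = 1 := by
  simp [vel, ordinaryCurve]

lemma wel_ordinaryCurve (hu : IntegrableOn u (Icc (0 : ℝ) 1)) :
    ∀ᵐ t ∂(volume.restrict (Icc (0 : ℝ) 1)), wel (ordinaryCurve u) t = u t := by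
  rw [ae_restrict_iff' measurableSet_Icc]
  filter_upwards [LocallyIntegrable.ae_hasDerivAt_integral
    (integrable_indicator_control hu).locallyIntegrable]
    with t ht h01
  have := (ht 0).deriv
  rw [indicator_of_mem h01] at this
  exact this

lemma exitParam_ordinaryCurve (u : ℝ → E k) : exitParam (ordinaryCurve u) 1 = 1 :=
  csSup_Icc (zero_le_one' ℝ)

lemma ordinaryCurve_mem_controlCurves (hu : IntegrableOn u (Icc (0 : ℝ) 1)) :
    ordinaryCurve u ∈ controlCurves k 1 := by
  refine ⟨acHalfLine_ordinaryCurve hu, rfl, ?_, ?_, ⟨2, by norm_num, by simp [ordinaryCurve]⟩,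
    by simp [ordinaryCurve]⟩
  · exact Eventually.of_forall fun t => by simp [vel_ordinaryCurve]
  · refine top_le_iff.1 ?_
    calc (⊤ : ℝ≥0∞) = ∫⁻ _ in Ici (0 : ℝ), 1 := by simp
      _ ≤ totalLength (ordinaryCurve u) := by
        refine lintegral_mono fun t => ?_
        rw [← ENNReal.ofReal_one]
        refine ENNReal.ofReal_le_ofReal (Real.one_le_sqrt.2 ?_)
        rw [vel_ordinaryCurve]
        nlinarith [sq_nonneg ‖wel (ordinaryCurve u) t‖]

/-- An ordinary control with trajectory `x` and integrable running cost, regarded as a generalized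
control, has endpoint `x 1` and cost `∫ L(x, u)`. -/
lemma hasEndpointCost_ordinaryCurve {n : ℕ} {f : E n → E n} {g : Fin k → E n → E n}
    {L : E n → E k → ℝ} {x₀ : E n} {x : ℝ → E n} (hu : IntegrableOn u (Icc (0 : ℝ) 1))
    (hx : IsOrdinaryTrajectory f g x₀ u x)
    (hL : IntegrableOn (fun t => L (x t) (u t)) (Icc (0 : ℝ) 1)) :
    HasEndpointCost f g L x₀ (frechetClass (ordinaryCurve u)) (x 1)
      ((∫ t in Icc (0 : ℝ) 1, L (x t) (u t) : ℝ) : EReal) := by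
  refine ⟨ordinaryCurve u, ordinaryCurve_mem_controlCurves hu,
    mem_frechetClass_self (acHalfLine_ordinaryCurve hu), x, ⟨?_, hx.2.1, ?_⟩, ?_, ?_⟩
  · rw [exitParam_ordinaryCurve]; exact hx.1
  · rw [exitParam_ordinaryCurve]
    filter_upwards [hx.2.2, wel_ordinaryCurve hu] with t h1 h2
    rw [h2, vel_ordinaryCurve, one_smul]; exact h1
  · rw [exitParam_ordinaryCurve]
  · rw [curveCost, exitParam_ordinaryCurve]
    refine extIntegral_eq_integral hL ?_
    filter_upwards [wel_ordinaryCurve hu] with t ht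
    simp [ht, vel_ordinaryCurve, auxLagrangian]

end OrdinaryCurve

/-! ### The auxiliary Lagrangian under the continuity hypothesis -/

lemma tendsto_div_nhdsGT_zero {c : ℝ} (hc : 0 < c) :
    Tendsto (fun η : ℝ => η / c) (𝓝[>] 0) (𝓝[>] 0) := by
  refine tendsto_nhdsWithin_iff.2 ⟨?_, ?_⟩
  · have : Tendsto (fun η : ℝ => η / c) (𝓝 0) (𝓝 (0 / c)) := (continuous_id.div_const c).tendsto 0
    rw [zero_div] at this
    exact this.mono_left nhdsWithin_le_nhds
  · filter_upwards [self_mem_nhdsWithin] with η hη using div_pos hη hc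

lemma tendsto_perspective_smul {m : ℕ} {ℓ : E m → ℝ} {w : E m} {a c : ℝ} (hc : 0 < c)
    (h : Tendsto (fun η : ℝ => ℓ (η⁻¹ • w) * η) (𝓝[>] 0) (𝓝 a)) :
    Tendsto (fun η : ℝ => ℓ (η⁻¹ • c • w) * η) (𝓝[>] 0) (𝓝 (c * a)) := by
  refine ((h.comp (tendsto_div_nhdsGT_zero hc)).const_mul c).congr fun η => ?_
  simp only [Function.comp_apply, inv_div, smul_smul]
  rw [show c / η = η⁻¹ * c by ring]
  field_simp

section AuxiliaryLagrangian

variable {n k : ℕ} {L : E n → E k → ℝ}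

/-- If the recession limit of `L(y, ·)` in direction `w` is finite, it is the value of the auxiliary
Lagrangian at `(y, 0, w)`. -/
lemma auxLagrangian_zero_eq {y : E n} {w : E k} {a : ℝ}
    (h : Tendsto (fun η : ℝ => L y (η⁻¹ • w) * η) (𝓝[>] 0) (𝓝 a)) :
    auxLagrangian L y 0 w = a := by
  rw [auxLagrangian, if_neg (lt_irrefl 0)]
  exact (EReal.tendsto_coe.2 h).limUnder_eq

lemma auxLagrangian_pos {y : E n} {v : ℝ} {w : E k} (hv : 0 < v) :
    auxLagrangian L y v w = ((L y (v⁻¹ • w) * v : ℝ) : EReal) := if_pos hv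

/-- Continuity of the auxiliary Lagrangian forces all recession limits to be finite: the value at
`(y, 0, 0)` is `0`, hence values near it are real, and a limit in direction `w` is a multiple of one
in a small direction. -/
lemma exists_tendsto_perspective
    (H : ContinuousOn (fun p : E n × (ℝ × E k) => auxLagrangian L p.1 p.2.1 p.2.2)
      (univ ×ˢ halfBall k)) (y : E n) (w : E k) :
    ∃ a : ℝ, Tendsto (fun η : ℝ => L y (η⁻¹ • w) * η) (𝓝[>] 0) (𝓝 a) := by
  have h00 : auxLagrangian L y 0 0 = (0 : ℝ) := by
    refine auxLagrangian_zero_eq ?_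
    simp only [smul_zero]
    have : Tendsto (fun η : ℝ => L y 0 * η) (𝓝 0) (𝓝 (L y 0 * 0)) :=
      (continuous_const_mul (L y 0)).tendsto 0
    rw [mul_zero] at this
    exact this.mono_left nhdsWithin_le_nhds
  -- the ray `s ↦ (y, 0, s • w)` stays in the half ball for small `s`
  have hball : ∀ᶠ s : ℝ in 𝓝 0, ‖s • w‖ ^ 2 < 1 := by
    have : ContinuousAt (fun s : ℝ => ‖s • w‖ ^ 2) 0 := by fun_prop
    exact this.eventually (gt_mem_nhds (by simp))
  have hray : Tendsto (fun s : ℝ => ((y, ((0 : ℝ), s • w)) : E n × (ℝ × E k))) (𝓝[>] 0)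
      (𝓝[univ ×ˢ halfBall k] (y, (0, 0))) := by
    refine tendsto_nhdsWithin_iff.2 ⟨?_, ?_⟩
    · have : ContinuousAt (fun s : ℝ => ((y, ((0 : ℝ), s • w)) : E n × (ℝ × E k))) 0 := by fun_prop
      have := this.tendsto
      simp only [zero_smul] at this
      exact this.mono_left nhdsWithin_le_nhds
    · filter_upwards [nhdsWithin_le_nhds hball] with s hs
      exact ⟨mem_univ _, le_rfl, by simpa using hs.le⟩
  have hlim := (H (y, (0, 0)) ⟨mem_univ _, by simp [halfBall]⟩).tendsto.comp hray
  simp only [h00] at hlim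
  have hIoo : Ioo ((-1 : ℝ) : EReal) ((1 : ℝ) : EReal) ∈ 𝓝 ((0 : ℝ) : EReal) :=
    Ioo_mem_nhds (by exact_mod_cast neg_one_lt_zero) (by exact_mod_cast zero_lt_one)
  obtain ⟨c, hc, hcw, hc0⟩ := ((hlim.eventually hIoo).and
    ((hball.filter_mono nhdsWithin_le_nhds).and eventually_mem_nhdsWithin)).exists
  have hc0 : 0 < c := hc0
  simp only [Function.comp_apply] at hc
  lift auxLagrangian L y 0 (c • w) to ℝ using
    ⟨(hc.2.trans (EReal.coe_lt_top _)).ne, ((EReal.bot_lt_coe _).trans hc.1).ne'⟩ with a ha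
  have hin : Tendsto (fun η : ℝ => ((y, (η, c • w)) : E n × (ℝ × E k))) (𝓝[>] 0)
      (𝓝[univ ×ˢ halfBall k] (y, (0, c • w))) := by
    refine tendsto_nhdsWithin_iff.2 ⟨?_, ?_⟩
    · have : ContinuousAt (fun η : ℝ => ((y, (η, c • w)) : E n × (ℝ × E k))) 0 := by fun_prop
      exact this.tendsto.mono_left nhdsWithin_le_nhds
    · have : ContinuousAt (fun η : ℝ => η ^ 2 + ‖c • w‖ ^ 2) 0 := by fun_prop
      have hlt : (0 : ℝ) ^ 2 + ‖c • w‖ ^ 2 < 1 := by rw [zero_pow two_ne_zero, zero_add]; exact hcw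
      filter_upwards [nhdsWithin_le_nhds (this.eventually (gt_mem_nhds hlt)),
        self_mem_nhdsWithin] with η h1 h2
      exact ⟨mem_univ _, le_of_lt h2, h1.le⟩
  have hreal : Tendsto (fun η : ℝ => L y (η⁻¹ • c • w) * η) (𝓝[>] 0) (𝓝 a) := by
    rw [← EReal.tendsto_coe, ha]
    refine ((H (y, (0, c • w)) ⟨mem_univ _, le_rfl, by simpa using hcw.le⟩).tendsto.comp
      hin).congr' ?_
    filter_upwards [self_mem_nhdsWithin] with η hη
    exact auxLagrangian_pos hη
  refine ⟨c⁻¹ * a, ?_⟩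
  simpa [smul_smul, hc0.ne'] using tendsto_perspective_smul (inv_pos.2 hc0) hreal

/-- A continuous auxiliary Lagrangian is a real-valued continuous function on `{v ≥ 0}`, of linear
growth in `(v, w)` uniformly for `y` in a compact set. -/
theorem exists_real_auxLagrangian
    (H : ContinuousOn (fun p : E n × (ℝ × E k) => auxLagrangian L p.1 p.2.1 p.2.2)
      (univ ×ˢ halfBall k)) :
    ∃ Λ : E n × (ℝ × E k) → ℝ,
      (∀ y v w, 0 ≤ v → auxLagrangian L y v w = (Λ (y, (v, w)) : EReal)) ∧
      ContinuousOn Λ {p | 0 ≤ p.2.1} ∧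
      ∀ K : Set (E n), IsCompact K → ∃ C, ∀ y ∈ K, ∀ v w, 0 ≤ v →
        |Λ (y, (v, w))| ≤ C * (v + ‖w‖) := by
  set Λ : E n × (ℝ × E k) → ℝ := fun p => (auxLagrangian L p.1 p.2.1 p.2.2).toReal with hΛ
  have hlim : ∀ y w, Tendsto (fun η : ℝ => L y (η⁻¹ • w) * η) (𝓝[>] 0) (𝓝 (Λ (y, (0, w)))) := by
    intro y w
    obtain ⟨a, ha⟩ := exists_tendsto_perspective H y w
    have : Λ (y, (0, w)) = a := by simp only [hΛ, auxLagrangian_zero_eq ha, EReal.toReal_coe]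
    rwa [this]
  have hval : ∀ y v w, 0 ≤ v → auxLagrangian L y v w = (Λ (y, (v, w)) : EReal) := by
    intro y v w hv
    rcases hv.eq_or_lt with rfl | hv
    · exact auxLagrangian_zero_eq (hlim y w)
    · simp only [hΛ, auxLagrangian_pos hv, EReal.toReal_coe]
  have hhom : ∀ y v w (c : ℝ), 0 ≤ v → 0 < c → Λ (y, (c * v, c • w)) = c * Λ (y, (v, w)) := by
    intro y v w c hv hc
    rcases hv.eq_or_lt with rfl | hv
    · rw [mul_zero]
      exact tendsto_nhds_unique (hlim y (c • w)) (tendsto_perspective_smul hc (hlim y w))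
    · simp only [hΛ, auxLagrangian_pos hv, auxLagrangian_pos (mul_pos hc hv), EReal.toReal_coe]
      rw [smul_smul, show (c * v)⁻¹ * c = v⁻¹ by field_simp]; ring
  have hcB : ContinuousOn Λ (univ ×ˢ halfBall k) := by
    intro p hp
    have := (H p hp).tendsto
    rw [hval _ _ _ hp.2.1] at this
    refine EReal.tendsto_coe.1 (this.congr' ?_)
    filter_upwards [self_mem_nhdsWithin] with q hq using hval _ _ _ hq.2.1
  have hscale : ∀ (v : ℝ) (w : E k) (c : ℝ), 0 ≤ v → 0 < c → v + ‖w‖ ≤ c →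
      (c⁻¹ * v, c⁻¹ • w) ∈ halfBall k := by
    intro v w c hv hc hle
    refine ⟨by positivity, ?_⟩
    simp only [norm_smul, norm_inv, Real.norm_of_nonneg hc.le]
    rw [mul_pow, mul_pow, ← mul_add, inv_pow, inv_mul_le_one₀ (by positivity)]
    nlinarith [norm_nonneg w]
  have hunscale : ∀ y v w (c : ℝ), 0 ≤ v → 0 < c →
      Λ (y, (v, w)) = c * Λ (y, (c⁻¹ * v, c⁻¹ • w)) := by
    intro y v w c hv hc
    rw [← hhom _ _ _ _ (by positivity) hc, smul_smul, mul_inv_cancel₀ hc.ne', one_smul,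
      mul_inv_cancel_left₀ hc.ne']
  refine ⟨Λ, hval, ?_, ?_⟩
  · rintro ⟨y, v, w⟩ hv
    have hv : 0 ≤ v := hv
    set c : ℝ := v + ‖w‖ + 1 with hc
    have hc0 : 0 < c := by positivity
    have hopen : {p : E n × (ℝ × E k) | p.2.1 + ‖p.2.2‖ < c} ∈ 𝓝 (y, (v, w)) :=
      (isOpen_lt (by fun_prop) continuous_const).mem_nhds (by simp [hc])
    have hcomp : ContinuousOn (fun p : E n × (ℝ × E k) => c * Λ (p.1, (c⁻¹ * p.2.1, c⁻¹ • p.2.2)))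
        {p | 0 ≤ p.2.1 ∧ p.2.1 + ‖p.2.2‖ < c} := by
      refine continuousOn_const.mul (hcB.comp (Continuous.continuousOn (by fun_prop)) ?_)
      exact fun p hp => ⟨mem_univ _, hscale _ _ _ hp.1 hc0 hp.2.le⟩
    have hcont : ContinuousOn Λ {p | 0 ≤ p.2.1 ∧ p.2.1 + ‖p.2.2‖ < c} :=
      hcomp.congr fun p hp => hunscale _ _ _ _ hp.1 hc0
    refine (hcont (y, (v, w)) ⟨hv, by simp [hc]⟩).mono_of_mem_nhdsWithin ?_
    exact inter_mem self_mem_nhdsWithin (nhdsWithin_le_nhds hopen)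
  · intro K hK
    have hcompact : IsCompact (halfBall k) := by
      refine Metric.isCompact_of_isClosed_isBounded ?_ ?_
      · exact (isClosed_le continuous_const continuous_fst).inter
          (isClosed_le (f := fun p : ℝ × E k => p.1 ^ 2 + ‖p.2‖ ^ 2) (by fun_prop) continuous_const)
      · refine (Metric.isBounded_closedBall (x := (0 : ℝ × E k)) (r := 1)).subset fun p hp => ?_
        rw [mem_closedBall_zero_iff, Prod.norm_def]
        have h2 := hp.2
        refine max_le (abs_le_one_iff_mul_self_le_one.2 ?_) ?_ <;>
        nlinarith [norm_nonneg p.2, sq_nonneg p.1, sq_nonneg ‖p.2‖]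
    obtain ⟨C, hC⟩ := (hK.prod hcompact).exists_bound_of_continuousOn
      (hcB.mono (prod_mono_left (subset_univ K)))
    refine ⟨C, fun y hy v w hv => ?_⟩
    rcases (add_nonneg hv (norm_nonneg w)).eq_or_lt with h0 | hpos
    · have hv0 : v = 0 := by linarith [norm_nonneg w]
      have hw0 : w = 0 := norm_eq_zero.1 (by linarith [norm_nonneg w])
      have := hhom y 0 0 2 le_rfl two_pos
      rw [mul_zero, smul_zero] at this
      rw [← h0, hv0, hw0, mul_zero, abs_nonpos_iff]
      linarith
    · rw [hunscale y v w _ hv hpos, abs_mul, abs_of_pos hpos, mul_comm]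
      exact mul_le_mul_of_nonneg_right (hC _ ⟨hy, hscale v w _ hv hpos le_rfl⟩) hpos.le

end AuxiliaryLagrangian

/-! ### Passing to ordinary time -/

section Clock

variable {v : ℝ → ℝ} {c S : ℝ}

/-- If the rate `v` is bounded below by a positive constant, the clock `t ↦ ∫₀ᵗ v` is an order
isomorphism of `ℝ`, with Lipschitz inverse. -/
lemma exists_clock (hv : ∀ a b, IntervalIntegrable v volume a b) (hc : 0 < c)
    (hvc : ∀ s, c ≤ v s) :
    ∃ e : ℝ ≃o ℝ, (∀ t, e t = ∫ s in (0 : ℝ)..t, v s) ∧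
      ∀ s t, dist (e.symm s) (e.symm t) ≤ c⁻¹ * dist s t := by
  set V : ℝ → ℝ := fun t => ∫ s in (0 : ℝ)..t, v s with hV
  have hlow : ∀ s t, s ≤ t → c * (t - s) ≤ V t - V s := fun s t hst => by
    simp only [hV]
    rw [intervalIntegral.integral_interval_sub_left (hv _ _) (hv _ _)]
    calc c * (t - s) = ∫ _ in s..t, c := by simp [mul_comm]
      _ ≤ _ := intervalIntegral.integral_mono_on hst intervalIntegrable_const (hv _ _)
        fun r _ => hvc r
  have hmono : StrictMono V := fun s t hst => by
    have := hlow s t hst.le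
    have h2 := mul_pos hc (sub_pos.2 hst)
    linarith
  have hV0 : V 0 = 0 := intervalIntegral.integral_same
  have hcont : Continuous V := intervalIntegral.continuous_primitive hv 0
  have htop : Tendsto V atTop atTop := by
    refine tendsto_atTop_mono' _ ?_ (tendsto_id.const_mul_atTop hc)
    filter_upwards [eventually_ge_atTop 0] with t ht
    simpa [hV0] using hlow 0 t ht
  have hbot : Tendsto V atBot atBot := by
    refine tendsto_atBot_mono' _ ?_ (tendsto_id.const_mul_atBot hc)
    filter_upwards [eventually_le_atBot 0] with t ht
    have := hlow t 0 ht
    simp only [id]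
    linarith
  set e := hmono.orderIsoOfSurjective V (hcont.surjective htop hbot)
  refine ⟨e, fun t => rfl, ?_⟩
  intro s t
  wlog hst : s ≤ t generalizing s t
  · rw [dist_comm, dist_comm s]; exact this t s (le_of_not_ge hst)
  have h1 := hlow _ _ (e.symm.monotone hst)
  have h2 : ∀ r, V (e.symm r) = r := e.apply_symm_apply
  rw [h2, h2] at h1
  rw [dist_comm, dist_comm s, Real.dist_eq, Real.dist_eq, abs_of_nonneg (sub_nonneg.2 hst),
    abs_of_nonneg (sub_nonneg.2 (e.symm.monotone hst)), inv_mul_eq_div, le_div_iff₀ hc]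
  linarith

/-- A measurable set of full measure in `[0,S]`, on which a given property that holds almost
everywhere is true and the clock has derivative `v`, and whose image under the clock has full
measure in `[0,1]`. It makes the change of variables available for differentiable injective
functions. -/
lemma exists_clock_good_set (hv : ∀ a b, IntervalIntegrable v volume a b) (hv0 : ∀ s, 0 < v s)
    (hS : 0 ≤ S) (e : ℝ ≃o ℝ) (he : ∀ t, e t = ∫ s in (0 : ℝ)..t, v s) (heS : e S = 1)
    {P : ℝ → Prop} (hP : ∀ᵐ s, s ∈ Ioo (0 : ℝ) S → P s) :
    ∃ A, MeasurableSet A ∧ A ⊆ Ioo 0 S ∧ A =ᵐ[volume] Icc 0 S ∧ e '' A =ᵐ[volume] Icc 0 1 ∧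
      ∀ s ∈ A, P s ∧ HasDerivAt e (v s) s := by
  have hQ : ∀ᵐ s, s ∈ Ioo (0 : ℝ) S → P s ∧ HasDerivAt e (v s) s := by
    filter_upwards [hP, (hv 0 S).ae_hasDerivAt_integral] with s h1 h2 hs
    refine ⟨h1 hs, ?_⟩
    have h3 := h2 (by rw [uIcc_of_le hS]; exact Ioo_subset_Icc_self hs) 0 left_mem_uIcc
    rwa [show (fun t => ∫ r in (0 : ℝ)..t, v r) = e from funext fun t => (he t).symm] at h3
  set N := toMeasurable volume {s | ¬ (s ∈ Ioo (0 : ℝ) S → P s ∧ HasDerivAt e (v s) s)} with hN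
  have hN0 : volume N = 0 := by rw [hN, measure_toMeasurable]; exact ae_iff.1 hQ
  have hA : MeasurableSet (Ioo 0 S \ N) := measurableSet_Ioo.diff (measurableSet_toMeasurable _ _)
  have hAP : ∀ s ∈ Ioo 0 S \ N, P s ∧ HasDerivAt e (v s) s := fun s hs => by
    by_contra hcon
    exact hs.2 (subset_toMeasurable _ _ fun h => hcon (h hs.1))
  have hAI : (Ioo 0 S \ N : Set ℝ) =ᵐ[volume] Icc 0 S :=
    (sdiff_null_ae_eq_self hN0).trans Ioo_ae_eq_Icc
  refine ⟨Ioo 0 S \ N, hA, sdiff_subset, hAI, ?_, hAP⟩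
  have he0 : e 0 = 0 := by rw [he, intervalIntegral.integral_same]
  refine ae_eq_of_subset_of_measure_ge ?_ ?_ ?_ (by simp)
  · rintro _ ⟨s, hs, rfl⟩
    rw [← he0, ← heS]
    exact ⟨e.monotone hs.1.1.le, e.monotone hs.1.2.le⟩
  · have h1 := lintegral_image_eq_lintegral_abs_deriv_mul hA
      (fun s hs => (hAP s hs).2.hasDerivWithinAt) e.injective.injOn (fun _ => 1)
    simp only [lintegral_const, one_mul, mul_one, MeasurableSet.univ,
      Measure.restrict_apply, univ_inter] at h1
    rw [h1, Real.volume_Icc, setLIntegral_congr hAI]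
    have hvI : IntegrableOn v (Icc 0 S) :=
      (intervalIntegrable_iff_integrableOn_Icc_of_le hS).1 (hv 0 S)
    simp only [abs_of_pos (hv0 _)]
    rw [← ofReal_integral_eq_lintegral_ofReal hvI (Eventually.of_forall fun s => (hv0 s).le),
      integral_Icc_eq_integral_Ioc, ← intervalIntegral.integral_of_le hS, ← he, heS, sub_zero]
  · exact ((e.toHomeomorph.measurableEmbedding.measurableSet_image' hA)).nullMeasurableSet

variable {F : Type*} [NormedAddCommGroup F] [NormedSpace ℝ F]

/-- Change of variables along the clock. -/
lemma integrableOn_clock_iff (hv : ∀ a b, IntervalIntegrable v volume a b) (hv0 : ∀ s, 0 < v s)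
    (hS : 0 ≤ S) (e : ℝ ≃o ℝ) (he : ∀ t, e t = ∫ s in (0 : ℝ)..t, v s) (heS : e S = 1)
    (G : ℝ → F) :
    (IntegrableOn G (Icc 0 1) ↔ IntegrableOn (fun s => v s • G (e s)) (Icc 0 S)) ∧
      ∫ t in Icc (0 : ℝ) 1, G t = ∫ s in Icc (0 : ℝ) S, v s • G (e s) := by
  obtain ⟨A, hA, -, hAI, hAe, hAd⟩ := exists_clock_good_set hv hv0 hS e he heS (P := fun _ => True)
    (Eventually.of_forall fun _ _ => trivial)
  have hd : ∀ s ∈ A, HasDerivWithinAt e (v s) A s := fun s hs => (hAd s hs).2.hasDerivWithinAt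
  constructor
  · rw [← integrableOn_congr_set_ae hAe, ← integrableOn_congr_set_ae hAI,
      integrableOn_image_iff_integrableOn_abs_deriv_smul hA hd e.injective.injOn]
    simp only [abs_of_pos (hv0 _)]
  · rw [← setIntegral_congr_set hAe, ← setIntegral_congr_set hAI,
      integral_image_eq_integral_abs_deriv_smul hA hd e.injective.injOn]
    simp only [abs_of_pos (hv0 _)]

end Clock

/-- A trajectory in parameter time whose clock runs at a rate bounded below by a positive constant
becomes, in ordinary time, the trajectory of an ordinary control with the same endpoint and the same
cost. -/
theorem exists_ordinary_control {n k : ℕ} {f : E n → E n} {g : Fin k → E n → E n}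
    {L : E n → E k → ℝ} {x₀ : E n} {v : ℝ → ℝ} {w : ℝ → E k} {z : ℝ → E n} {c S : ℝ}
    (hS : 0 ≤ S) (hv : ∀ a b, IntervalIntegrable v volume a b) (hc : 0 < c) (hvc : ∀ s, c ≤ v s)
    (hv1 : ∫ s in (0 : ℝ)..S, v s = 1) (hw : IntegrableOn w (Icc 0 S))
    (hh : IntervalIntegrable (fun s => v s • f (z s) + ∑ i, w s i • g i (z s)) volume 0 S)
    (hz : ∀ t ∈ Icc (0 : ℝ) S,
      z t = x₀ + ∫ s in (0 : ℝ)..t, (v s • f (z s) + ∑ i, w s i • g i (z s)))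
    (hcost : IntegrableOn (fun s => L (z s) ((v s)⁻¹ • w s) * v s) (Icc 0 S)) :
    ∃ (u : ℝ → E k) (x : ℝ → E n), IntegrableOn u (Icc (0 : ℝ) 1) ∧
      IsOrdinaryTrajectory f g x₀ u x ∧ x 1 = z S ∧
      IntegrableOn (fun t => L (x t) (u t)) (Icc (0 : ℝ) 1) ∧
      ∫ t in Icc (0 : ℝ) 1, L (x t) (u t) =
        ∫ s in Icc (0 : ℝ) S, L (z s) ((v s)⁻¹ • w s) * v s := by
  have hv0 : ∀ s, 0 < v s := fun s => hc.trans_le (hvc s)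
  obtain ⟨e, he, hlip⟩ := exists_clock hv hc hvc
  have heS : e S = 1 := by rw [he, hv1]
  have he0 : e 0 = 0 := by rw [he, intervalIntegral.integral_same]
  have hs0 : e.symm 0 = 0 := by simpa only [he0] using e.symm_apply_apply 0
  have hs1 : e.symm 1 = S := by rw [← heS, e.symm_apply_apply]
  have hz' : ∀ᵐ s, s ∈ Ioo (0 : ℝ) S →
      HasDerivAt z (v s • f (z s) + ∑ i, w s i • g i (z s)) s := by
    filter_upwards [hh.ae_hasDerivAt_integral] with s h1 hs
    have h2 := (h1 (by rw [uIcc_of_le hS]; exact Ioo_subset_Icc_self hs) 0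
      left_mem_uIcc).const_add x₀
    refine h2.congr_of_eventuallyEq ?_
    filter_upwards [isOpen_Ioo.mem_nhds hs] with t ht using hz t (Ioo_subset_Icc_self ht)
  obtain ⟨A, -, hAS, -, hAe, hAd⟩ := exists_clock_good_set hv hv0 hS e he heS hz'
  have hcostG := integrableOn_clock_iff hv hv0 hS e he heS
    (fun t => L (z (e.symm t)) ((v (e.symm t))⁻¹ • w (e.symm t)))
  simp only [OrderIso.symm_apply_apply, smul_eq_mul, mul_comm (v _)] at hcostG
  refine ⟨fun t => (v (e.symm t))⁻¹ • w (e.symm t), z ∘ e.symm, ?_, ⟨?_, ?_, ?_⟩, ?_,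
    hcostG.1.2 hcost, hcostG.2⟩
  · rw [(integrableOn_clock_iff hv hv0 hS e he heS _).1]
    simpa only [OrderIso.symm_apply_apply, smul_smul, mul_inv_cancel₀ (hv0 _).ne', one_smul] using hw
  · refine absolutelyContinuousOnInterval_comp_monotone (c := 0) (d := S) ?_ e.symm.monotone hlip ?_
    · refine absolutelyContinuousOnInterval_of_dist_le 1
        (absolutelyContinuousOnInterval_integral hh) fun s hs t ht => ?_
      rw [uIcc_of_le hS] at hs ht
      rw [hz s hs, hz t ht, one_mul, dist_add_left]
    · intro t ht
      rw [uIcc_of_le zero_le_one] at ht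
      rw [uIcc_of_le hS, ← hs1, ← hs0]
      exact ⟨e.symm.monotone ht.1, e.symm.monotone ht.2⟩
  · rw [Function.comp_apply, hs0, hz 0 (left_mem_Icc.2 hS), intervalIntegral.integral_same, add_zero]
  · rw [ae_restrict_iff' measurableSet_Icc]
    filter_upwards [hAe.mem_iff] with t ht h01
    obtain ⟨s, hs, rfl⟩ := ht.2 h01
    have hde : HasDerivAt e.symm (v s)⁻¹ (e s) := by
      refine HasDerivAt.of_local_left_inverse (f := e) e.symm.continuous.continuousAt ?_
        (hv0 s).ne' (Eventually.of_forall e.apply_symm_apply)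
      rw [e.symm_apply_apply]; exact (hAd s hs).2
    have hdz : HasDerivAt z (v s • f (z s) + ∑ i, w s i • g i (z s)) (e.symm (e s)) := by
      rw [e.symm_apply_apply]; exact (hAd s hs).1
    refine (hdz.scomp (e s) hde).congr_deriv ?_
    simp only [Function.comp_apply, e.symm_apply_apply, smul_add, smul_smul,
      inv_mul_cancel₀ (hv0 s).ne', one_smul, Finset.smul_sum, PiLp.smul_apply, smul_eq_mul]
  · rw [Function.comp_apply, hs1]

/-! ### Perturbing the clock of a generalized control -/

section PerturbedClock

variable {n k : ℕ} {f : E n → E n} {g : Fin k → E n → E n}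

lemma intervalIntegrable_controlled_field (hf : Continuous f) (hg : ∀ i, Continuous (g i)) {S : ℝ}
    (hS : 0 ≤ S) {v : ℝ → ℝ} {w : ℝ → E k} {z : ℝ → E n} (hv : IntervalIntegrable v volume 0 S)
    (hw : IntervalIntegrable w volume 0 S) (hz : ContinuousOn z (Icc 0 S)) :
    IntervalIntegrable (fun s => v s • f (z s) + ∑ i, w s i • g i (z s)) volume 0 S := by
  rw [← uIcc_of_le hS] at hz
  have hwi : ∀ i, IntervalIntegrable (fun s => w s i) volume 0 S := fun i =>
    ⟨(EuclideanSpace.proj i : E k →L[ℝ] ℝ).integrable_comp hw.1,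
      (EuclideanSpace.proj i : E k →L[ℝ] ℝ).integrable_comp hw.2⟩
  refine (hv.smul_continuousOn (hf.comp_continuousOn hz)).add ?_
  simpa only [Finset.sum_fn, Pi.smul_apply', Function.comp_apply] using! IntervalIntegrable.sum
    Finset.univ fun i _ => (hwi i).smul_continuousOn ((hg i).comp_continuousOn hz)

/-- If `v ≥ 0` has integral `1` over `[0,S]`, the perturbed rate `(v + δ)/(1 + δS)` also has integral
`1`, and for small `δ` the trajectory driven by it exists on `[0,S]` and is within `O(δ)` of the
trajectory driven by `v`. -/
theorem exists_trajectory_perturbed_clock (hf : LocallyLipschitz f) (hg : ∀ i, LocallyLipschitz (g i))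
    {x₀ : E n} {S : ℝ} (hS : 0 ≤ S) {v : ℝ → ℝ} {w : ℝ → E k} {y : ℝ → E n} (hv0 : ∀ s, 0 ≤ v s)
    (hv : IntervalIntegrable v volume 0 S) (hv1 : ∫ s in (0 : ℝ)..S, v s = 1)
    (hw : IntervalIntegrable w volume 0 S) (hy : ContinuousOn y (Icc 0 S))
    (hyeq : ∀ t ∈ Icc (0 : ℝ) S,
      y t = x₀ + ∫ s in (0 : ℝ)..t, (v s • f (y s) + ∑ i, w s i • g i (y s))) :
    ∃ B, 0 ≤ B ∧ ∀ δ, 0 < δ → δ ≤ 1 → B * δ ≤ 1 → ∃ z : ℝ → E n, ContinuousOn z (Icc 0 S) ∧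
      (∀ t ∈ Icc (0 : ℝ) S, z t = x₀ + ∫ s in (0 : ℝ)..t,
        (((v s + δ) / (1 + δ * S)) • f (z s) + ∑ i, w s i • g i (z s))) ∧
      ∀ t ∈ Icc (0 : ℝ) S, ‖z t - y t‖ ≤ B * δ := by
  obtain ⟨R, hR⟩ := isCompact_Icc.exists_bound_of_continuousOn hy
  obtain ⟨C, hC⟩ := isCompact_Icc.exists_bound_of_continuousOn (hf.continuous.comp_continuousOn hy)
  have hC0 : 0 ≤ C := (norm_nonneg _).trans (hC 0 (left_mem_Icc.2 hS))
  have hball : IsCompact (Metric.closedBall (0 : E n) (R + 1)) := isCompact_closedBall _ _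
  obtain ⟨Kf, hKf⟩ := LocallyLipschitzOn.exists_lipschitzOnWith_of_compact hball
    hf.locallyLipschitzOn
  choose Kg hKg using fun i => LocallyLipschitzOn.exists_lipschitzOnWith_of_compact hball
    (hg i).locallyLipschitzOn
  set G : ℝ := ∑ i, (Kg i : ℝ) with hG
  have hG0 : 0 ≤ G := Finset.sum_nonneg fun i _ => (Kg i).2
  set m : ℝ → ℝ := fun s => (v s + 1) * Kf + ‖w s‖ * G with hm
  have hm0 : ∀ s, 0 ≤ m s := fun s => by
    have := hv0 s
    positivity
  have hmi : IntervalIntegrable m volume 0 S :=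
    ((hv.add intervalIntegrable_const).mul_const _).add (hw.norm.mul_const _)
  set X : ℝ := Real.exp (2 * ∫ r in (0 : ℝ)..S, m r) with hX
  have hX0 : 0 < X := Real.exp_pos _
  refine ⟨2 * (2 * C * S) * X, by positivity, fun δ hδ hδ1 hB => ?_⟩
  have hden : 0 < 1 + δ * S := by positivity
  have hvδ : IntervalIntegrable (fun s => (v s + δ) / (1 + δ * S)) volume 0 S :=
    (hv.add intervalIntegrable_const).div_const _
  have hvδ0 : ∀ s, 0 ≤ (v s + δ) / (1 + δ * S) := fun s => by
    have := hv0 s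
    positivity
  have hvδ1 : ∀ s, (v s + δ) / (1 + δ * S) ≤ v s + 1 := fun s => by
    have := hv0 s
    rw [div_le_iff₀ hden]
    have : 0 ≤ (v s + 1) * (δ * S) := by positivity
    linarith
  have hvdist : ∀ s, |(v s + δ) / (1 + δ * S) - v s| ≤ δ * (1 + S * v s) := fun s => by
    have := hv0 s
    have h1 : (v s + δ) / (1 + δ * S) - v s = δ * (1 - S * v s) / (1 + δ * S) := by
      field_simp; ring
    have h2 : |1 - S * v s| ≤ 1 + S * v s := by
      have : 0 ≤ S * v s := by positivity
      rw [abs_le]; constructor <;> linarith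
    rw [h1, abs_div, abs_mul, abs_of_pos hδ, abs_of_pos hden]
    refine (div_le_self (by positivity) ?_).trans (mul_le_mul_of_nonneg_left h2 hδ.le)
    have : 0 ≤ δ * S := by positivity
    linarith
  have hlip : ∀ s ∈ Icc (0 : ℝ) S, ∀ p q, ‖p - y s‖ ≤ 1 → ‖q - y s‖ ≤ 1 →
      ‖(((v s + δ) / (1 + δ * S)) • f p + ∑ i, w s i • g i p) -
        (((v s + δ) / (1 + δ * S)) • f q + ∑ i, w s i • g i q)‖ ≤ m s * ‖p - q‖ := by
    intro s hs p q hp hq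
    have hmem : ∀ p, ‖p - y s‖ ≤ 1 → p ∈ Metric.closedBall (0 : E n) (R + 1) := fun p hp => by
      rw [mem_closedBall_zero_iff]
      have := norm_le_norm_add_norm_sub (y s) p
      have := hR s hs
      rw [norm_sub_rev] at hp
      linarith
    have e1 : ‖f p - f q‖ ≤ Kf * ‖p - q‖ := by
      simpa only [dist_eq_norm] using hKf.dist_le_mul _ (hmem p hp) _ (hmem q hq)
    have e2 : ∀ i, ‖g i p - g i q‖ ≤ Kg i * ‖p - q‖ := fun i => by
      simpa only [dist_eq_norm] using (hKg i).dist_le_mul _ (hmem p hp) _ (hmem q hq)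
    rw [add_sub_add_comm, ← smul_sub, ← Finset.sum_sub_distrib]
    simp only [← smul_sub]
    calc _ ≤ ‖((v s + δ) / (1 + δ * S)) • (f p - f q)‖ + ‖∑ i, w s i • (g i p - g i q)‖ :=
          norm_add_le _ _
      _ ≤ (v s + 1) * (Kf * ‖p - q‖) + ∑ i, ‖w s‖ * (Kg i * ‖p - q‖) := by
          refine add_le_add ?_ ((norm_sum_le _ _).trans (Finset.sum_le_sum fun i _ => ?_))
          · rw [norm_smul, Real.norm_of_nonneg (hvδ0 s)]
            exact mul_le_mul (hvδ1 s) e1 (norm_nonneg _) (by have := hv0 s; positivity)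
          · rw [norm_smul]
            exact mul_le_mul (PiLp.norm_apply_le _ i) (e2 i) (norm_nonneg _) (norm_nonneg _)
      _ = m s * ‖p - q‖ := by
          rw [← Finset.mul_sum, ← Finset.sum_mul]; ring
  have hdef : ∀ t ∈ Icc (0 : ℝ) S, ‖x₀ + (∫ s in (0 : ℝ)..t,
      (((v s + δ) / (1 + δ * S)) • f (y s) + ∑ i, w s i • g i (y s))) - y t‖ ≤
        2 * C * S * δ := by
    intro t ht
    have hsub : uIcc (0 : ℝ) t ⊆ uIcc 0 S := by
      rw [uIcc_of_le ht.1, uIcc_of_le hS]; exact Icc_subset_Icc_right ht.2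
    have hc1 := (intervalIntegrable_controlled_field hf.continuous (fun i => (hg i).continuous)
      hS hvδ hw hy).mono_set hsub
    have hc2 := (intervalIntegrable_controlled_field hf.continuous (fun i => (hg i).continuous)
      hS hv hw hy).mono_set hsub
    rw [hyeq t ht, add_sub_add_left_eq_sub, ← intervalIntegral.integral_sub hc1 hc2]
    have hbi : IntervalIntegrable (fun s => δ * (1 + S * v s) * C) volume 0 S :=
      ((intervalIntegrable_const.add (hv.const_mul S)).const_mul δ).mul_const C
    calc _ ≤ ∫ s in (0 : ℝ)..t, δ * (1 + S * v s) * C := by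
          refine intervalIntegral.norm_integral_le_of_norm_le ht.1
            (Eventually.of_forall fun s hs => ?_) (hbi.mono_set hsub)
          rw [add_sub_add_right_eq_sub, ← sub_smul, norm_smul]
          exact mul_le_mul (hvdist s) (hC s ⟨hs.1.le, hs.2.trans ht.2⟩) (norm_nonneg _)
            ((abs_nonneg _).trans (hvdist s))
      _ ≤ ∫ s in (0 : ℝ)..S, δ * (1 + S * v s) * C := by
          refine intervalIntegral.integral_mono_interval le_rfl ht.1 ht.2
            (Eventually.of_forall fun s => ?_) hbi
          have := hv0 s
          simp only [Pi.zero_apply]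
          positivity
      _ = 2 * C * S * δ := by
          rw [intervalIntegral.integral_mul_const, intervalIntegral.integral_const_mul,
            intervalIntegral.integral_add intervalIntegrable_const (hv.const_mul S),
            intervalIntegral.integral_const_mul, hv1]
          simp; ring
  obtain ⟨z, hz1, hz2, hz3⟩ := exists_solution_near hS hmi hm0 hy
    (fun z hz => intervalIntegrable_controlled_field hf.continuous (fun i => (hg i).continuous)
      hS hvδ hw hz) hlip (by positivity) hdef (le_trans (le_of_eq (by simp only [hX]; ring)) hB)
  exact ⟨z, hz1, hz2, fun t ht => (hz3 t ht).trans_eq (by ring)⟩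

end PerturbedClock

/-! ### Generalized controls up to their exit parameter -/

/-- Up to its exit parameter `S`, a control curve has integrable velocity, and its clock `V` runs
from `0` to `1`. -/
lemma controlCurves_exitParam {k : ℕ} {γ : ℝ → ℝ × E k} (hγ : γ ∈ controlCurves k 1) :
    0 ≤ exitParam γ 1 ∧ IntervalIntegrable (vel γ) volume 0 (exitParam γ 1) ∧
      IntervalIntegrable (wel γ) volume 0 (exitParam γ 1) ∧
      ∫ s in (0 : ℝ)..exitParam γ 1, vel γ s = 1 := by
  obtain ⟨hac, hV0, hpos, -, ⟨t₀, ht₀, hVt₀⟩, -⟩ := hγ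
  set V : ℝ → ℝ := fun s => (γ s).1 with hV
  have hVac : ∀ T, 0 ≤ T → AbsolutelyContinuousOnInterval V 0 T := fun T hT =>
    absolutelyContinuousOnInterval_of_dist_le 1 (hac T hT) fun s _ t _ => by
      rw [one_mul]; exact le_max_left _ _
  have hWac : ∀ T, 0 ≤ T → AbsolutelyContinuousOnInterval (fun s => (γ s).2) 0 T := fun T hT =>
    absolutelyContinuousOnInterval_of_dist_le 1 (hac T hT) fun s _ t _ => by
      rw [one_mul]; exact le_max_right _ _
  have hvi : ∀ T, 0 ≤ T → IntervalIntegrable (vel γ) volume 0 T := fun T hT =>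
    (hVac T hT).intervalIntegrable_deriv
  have hint : ∀ T, 0 ≤ T → ∫ s in (0 : ℝ)..T, vel γ s = V T := fun T hT => by
    have h1 := (hVac T hT).integral_deriv_eq_sub
    have h2 : V 0 = 0 := hV0
    rw [h2, sub_zero] at h1
    exact h1
  have hmono : ∀ s t, 0 ≤ s → s ≤ t → V s ≤ V t := fun s t hs hst => by
    rw [← hint s hs, ← hint t (hs.trans hst)]
    refine intervalIntegral.integral_mono_interval le_rfl hs hst ?_ (hvi t (hs.trans hst))
    exact ae_restrict_of_ae_restrict_of_subset (fun r hr => hr.1.le) hpos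
  have hcont : ContinuousOn V (Icc 0 t₀) := by
    rw [← uIcc_of_le ht₀]; exact (hVac t₀ ht₀).continuousOn
  obtain ⟨s, hs, hs1⟩ : ∃ s ∈ Icc 0 t₀, V s = 1 :=
    intermediate_value_Icc ht₀ hcont ⟨le_of_eq_of_le hV0 zero_le_one, hVt₀.le⟩
  have hset : {r : ℝ | 0 ≤ r ∧ (γ r).1 ≤ 1} = Icc 0 t₀ ∩ V ⁻¹' Iic 1 := by
    ext r
    refine ⟨fun hr => ⟨⟨hr.1, ?_⟩, hr.2⟩, fun hr => ⟨hr.1.1, hr.2⟩⟩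
    by_contra hlt
    have h1 := hmono t₀ r ht₀ (not_le.1 hlt).le
    have h2 : V r ≤ 1 := hr.2
    have h3 : 1 < V t₀ := hVt₀
    linarith
  have hcpt : IsCompact {r : ℝ | 0 ≤ r ∧ (γ r).1 ≤ 1} := by
    rw [hset]
    exact isCompact_Icc.of_isClosed_subset (hcont.preimage_isClosed_of_isClosed isClosed_Icc
      isClosed_Iic) inter_subset_left
  have hmemS : s ∈ {r : ℝ | 0 ≤ r ∧ (γ r).1 ≤ 1} := ⟨hs.1, hs1.le⟩
  have hexit := hcpt.sSup_mem ⟨s, hmemS⟩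
  have hle : s ≤ exitParam γ 1 := le_csSup hcpt.bddAbove hmemS
  have hS0 : 0 ≤ exitParam γ 1 := hexit.1
  refine ⟨hS0, hvi _ hS0, (ae_differentiableAt_and_intervalIntegrable_deriv (hWac _ hS0)).2, ?_⟩
  rw [hint _ hS0]
  exact le_antisymm hexit.2 (hs1.symm.le.trans (hmono s _ hs.1 hle))

/-! ### Approximation by ordinary controls -/

section Approximation

variable {n k : ℕ} {f : E n → E n} {g : Fin k → E n → E n} {L : E n → E k → ℝ}

/-- The generalized control `γ` has a finite cost, and its endpoint and cost are approximated by
those of ordinary controls: perturb the clock so that it never stops, pass to ordinary time, and apply dominated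
convergence to the costs. -/
theorem exists_ordinary_approximation (hf : LocallyLipschitz f) (hg : ∀ i, LocallyLipschitz (g i))
    (hL : Continuous fun p : E n × E k => L p.1 p.2)
    (H : ContinuousOn (fun p : E n × (ℝ × E k) => auxLagrangian L p.1 p.2.1 p.2.2)
      (univ ×ˢ halfBall k))
    {x₀ : E n} {γ : ℝ → ℝ × E k} {y : ℝ → E n} (hγ : γ ∈ controlCurves k 1)
    (hy : IsGeneralizedTrajectory f g x₀ γ y) :
    ∃ C : ℝ, curveCost L γ y = C ∧ ∀ ε > 0, ∃ (u : ℝ → E k) (x : ℝ → E n) (r : ℝ),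
      IntegrableOn u (Icc (0 : ℝ) 1) ∧ IsOrdinaryTrajectory f g x₀ u x ∧
      ‖x 1 - y (exitParam γ 1)‖ ≤ ε ∧
      HasEndpointCost f g L x₀ (frechetClass (ordinaryCurve u)) (x 1) (r : EReal) ∧ r ≤ C + ε := by
  obtain ⟨Λ, hΛval, hΛcont, hΛbound⟩ := exists_real_auxLagrangian H
  obtain ⟨hS, hveli, hw, hvel1⟩ := controlCurves_exitParam hγ
  obtain ⟨hyac, hy0, hyd⟩ := hy
  have hvelpos := hγ.2.2.1
  set S := exitParam γ 1 with hSdef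
  set w : ℝ → E k := wel γ with hwdef
  -- a rate that is nonnegative and integrable on the whole line, equal to `vel γ` almost everywhere
  -- on `[0,S]`
  set v : ℝ → ℝ := (Icc 0 S).indicator fun s => max (vel γ s) 0 with hvdef
  have hvv : ∀ᵐ s ∂(volume.restrict (Icc 0 S)), v s = vel γ s := by
    filter_upwards [ae_restrict_of_ae_restrict_of_subset Icc_subset_Ici_self hvelpos,
      ae_restrict_mem measurableSet_Icc] with s h1 h2
    rw [hvdef, indicator_of_mem h2, max_eq_left h1]
  have hvv' : ∀ᵐ s, s ∈ Icc 0 S → v s = vel γ s := (ae_restrict_iff' measurableSet_Icc).1 hvv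
  have hv0 : ∀ s, 0 ≤ v s := fun s => indicator_nonneg (fun _ _ => le_max_right _ _) s
  have hvelI : IntegrableOn (vel γ) (Icc 0 S) :=
    (intervalIntegrable_iff_integrableOn_Icc_of_le hS).1 hveli
  have hwI : IntegrableOn w (Icc 0 S) :=
    (intervalIntegrable_iff_integrableOn_Icc_of_le hS).1 hw
  have hvint : Integrable v := (integrable_indicator_iff measurableSet_Icc).2 hvelI.pos_part
  have hvi : ∀ a b, IntervalIntegrable v volume a b := fun a b => hvint.intervalIntegrable
  have hv1 : ∫ s in (0 : ℝ)..S, v s = 1 := by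
    rw [← hvel1]
    refine intervalIntegral.integral_congr_ae ?_
    filter_upwards [hvv'] with s hs hmem
    rw [uIoc_of_le hS] at hmem
    exact hs ⟨hmem.1.le, hmem.2⟩
  have hyc : ContinuousOn y (Icc 0 S) := by rw [← uIcc_of_le hS]; exact hyac.continuousOn
  have hyeq : ∀ t ∈ Icc (0 : ℝ) S,
      y t = x₀ + ∫ s in (0 : ℝ)..t, (v s • f (y s) + ∑ i, w s i • g i (y s)) := fun t ht => by
    rw [← hy0]
    refine eq_add_integral_of_ae_hasDerivAt hyac (intervalIntegrable_controlled_field hf.continuous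
      (fun i => (hg i).continuous) hS (hvi 0 S) hw hyc) ?_ (by rwa [uIcc_of_le hS])
    filter_upwards [(ae_restrict_iff' measurableSet_Icc).1 hyd, hvv'] with s h1 h2 hs
    rw [uIcc_of_le hS] at hs
    rw [h2 hs]; exact h1 hs
  obtain ⟨B, hB0, hB⟩ := exists_trajectory_perturbed_clock hf hg hS hv0 (hvi 0 S) hv1 hw hyc hyeq
  -- the perturbation parameters, with `B * δ j ≤ 1` and `δ j → 0`
  set δ : ℕ → ℝ := fun j => (B + 1)⁻¹ * (1 / ((j : ℝ) + 1)) with hδ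
  have hδpos : ∀ j, 0 < δ j := fun j => by positivity
  have hδle : ∀ j, δ j ≤ (B + 1)⁻¹ := fun j =>
    mul_le_of_le_one_right (by positivity) (by
      rw [div_le_one (by positivity)]; linarith [(Nat.cast_nonneg j : (0 : ℝ) ≤ j)])
  have hδ1 : ∀ j, δ j ≤ 1 := fun j => (hδle j).trans (inv_le_one_of_one_le₀ (by linarith))
  have hBδ : ∀ j, B * δ j ≤ 1 := fun j => by
    refine (mul_le_mul_of_nonneg_left (hδle j) hB0).trans ?_
    rw [← div_eq_mul_inv, div_le_one (by positivity)]; linarith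
  have hδlim : Tendsto δ atTop (𝓝 0) := by
    simpa only [mul_zero] using tendsto_one_div_add_atTop_nhds_zero_nat.const_mul (B + 1)⁻¹
  choose z hzc hzeq hzy using fun j => hB (δ j) (hδpos j) (hδ1 j) (hBδ j)
  set V : ℕ → ℝ → ℝ := fun j s => (v s + δ j) / (1 + δ j * S) with hV
  have hden : ∀ j, 1 ≤ 1 + δ j * S := fun j => by
    have := mul_nonneg (hδpos j).le hS
    linarith
  have hVlow : ∀ j s, δ j / (1 + δ j * S) ≤ V j s := fun j s =>
    div_le_div_of_nonneg_right (by linarith [hv0 s]) (by linarith [hden j])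
  have hVc : ∀ j, 0 < δ j / (1 + δ j * S) := fun j =>
    div_pos (hδpos j) (by linarith [hden j])
  have hVpos : ∀ j s, 0 < V j s := fun j s => (hVc j).trans_le (hVlow j s)
  have hVle : ∀ j s, V j s ≤ v s + 1 := fun j s =>
    (div_le_self (by linarith [hv0 s, hδpos j]) (hden j)).trans (by linarith [hδ1 j])
  have hVi : ∀ j a b, IntervalIntegrable (V j) volume a b := fun j a b =>
    ((hvi a b).add intervalIntegrable_const).div_const _
  have hV1 : ∀ j, ∫ s in (0 : ℝ)..S, V j s = 1 := fun j => by
    simp only [hV]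
    rw [intervalIntegral.integral_div, intervalIntegral.integral_add (hvi 0 S)
      intervalIntegrable_const, hv1, intervalIntegral.integral_const, sub_zero, smul_eq_mul,
      mul_comm S, div_self (by linarith [hden j])]
  -- all the trajectories stay in a fixed ball, where `Λ` has linear growth
  obtain ⟨R, hR⟩ := isCompact_Icc.exists_bound_of_continuousOn hyc
  obtain ⟨M, hM⟩ := hΛbound (Metric.closedBall 0 (R + 1)) (isCompact_closedBall _ _)
  have hzball : ∀ j, ∀ s ∈ Icc 0 S, z j s ∈ Metric.closedBall (0 : E n) (R + 1) := fun j s hs => by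
    rw [mem_closedBall_zero_iff]
    have h1 := (hzy j s hs).trans (hBδ j)
    have h2 := hR s hs
    rw [norm_sub_rev] at h1
    linarith [norm_le_norm_add_norm_sub (y s) (z j s)]
  set bound : ℝ → ℝ := fun s => |M| * (v s + 1 + ‖w s‖) with hbound
  have hboundI : IntegrableOn bound (Icc 0 S) :=
    ((hvint.integrableOn.add (integrable_const 1)).add hwI.norm).const_mul _
  have hdom : ∀ j, ∀ s ∈ Icc 0 S, |Λ (z j s, (V j s, w s))| ≤ bound s := fun j s hs => by
    refine (hM _ (hzball j s hs) _ _ (hVpos j s).le).trans ?_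
    refine mul_le_mul (le_abs_self M) (by linarith [hVle j s]) ?_ (abs_nonneg M)
    linarith [hVpos j s, norm_nonneg (w s)]
  have hcost : ∀ j s, L (z j s) ((V j s)⁻¹ • w s) * V j s = Λ (z j s, (V j s, w s)) :=
    fun j s => by
      have h1 := hΛval (z j s) (V j s) (w s) (hVpos j s).le
      rw [auxLagrangian_pos (hVpos j s)] at h1
      exact EReal.coe_injective h1
  have hmeas : ∀ j, AEStronglyMeasurable (fun s => Λ (z j s, (V j s, w s)))
      (volume.restrict (Icc 0 S)) := fun j => by
    simp only [← hcost]
    have h1 : AEMeasurable (V j) (volume.restrict (Icc 0 S)) :=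
      ((hvint.aemeasurable.add_const _).div_const _).restrict
    have h2 : AEStronglyMeasurable (fun s => (V j s)⁻¹ • w s) (volume.restrict (Icc 0 S)) :=
      h1.inv.aestronglyMeasurable.smul hwI.aestronglyMeasurable
    exact (hL.comp_aestronglyMeasurable
      (((hzc j).aestronglyMeasurable measurableSet_Icc).prodMk h2)).mul h1.aestronglyMeasurable
  have hint : ∀ j, IntegrableOn (fun s => Λ (z j s, (V j s, w s))) (Icc 0 S) := fun j =>
    Integrable.mono' hboundI (hmeas j) ((ae_restrict_mem measurableSet_Icc).mono (hdom j))
  have hptw : ∀ s ∈ Icc 0 S, Tendsto (fun j => Λ (z j s, (V j s, w s))) atTop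
      (𝓝 (Λ (y s, (v s, w s)))) := fun s hs => by
    have hz : Tendsto (fun j => z j s) atTop (𝓝 (y s)) := by
      rw [tendsto_iff_norm_sub_tendsto_zero]
      refine squeeze_zero (fun _ => norm_nonneg _) (fun j => hzy j s hs) ?_
      simpa using hδlim.const_mul B
    have hVs : Tendsto (fun j => V j s) atTop (𝓝 (v s)) := by
      have := (hδlim.const_add (v s)).div ((hδlim.mul_const S).const_add 1) (by simp)
      simpa only [zero_mul, add_zero, div_one] using! this
    refine (hΛcont (y s, (v s, w s)) (hv0 s)).tendsto.comp (tendsto_nhdsWithin_iff.2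
      ⟨hz.prodMk_nhds (hVs.prodMk_nhds tendsto_const_nhds), Eventually.of_forall fun j =>
        (hVpos j s).le⟩)
  have hlim : Tendsto (fun j => ∫ s in Icc 0 S, Λ (z j s, (V j s, w s))) atTop
      (𝓝 (∫ s in Icc 0 S, Λ (y s, (v s, w s)))) :=
    tendsto_integral_of_dominated_convergence bound hmeas hboundI
      (fun j => (ae_restrict_mem measurableSet_Icc).mono (hdom j))
      ((ae_restrict_mem measurableSet_Icc).mono hptw)
  have hyint : IntegrableOn (fun s => Λ (y s, (v s, w s))) (Icc 0 S) := by
    refine Integrable.mono' hboundI (aestronglyMeasurable_of_tendsto_ae atTop hmeas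
      ((ae_restrict_mem measurableSet_Icc).mono hptw)) ?_
    filter_upwards [ae_restrict_mem measurableSet_Icc] with s hs
    exact le_of_tendsto (hptw s hs).norm (Eventually.of_forall fun j => hdom j s hs)
  refine ⟨∫ s in Icc 0 S, Λ (y s, (v s, w s)), ?_, fun ε hε => ?_⟩
  · rw [curveCost]
    refine extIntegral_eq_integral hyint ?_
    filter_upwards [hvv] with s hs
    rw [← hΛval _ _ _ (hv0 s), hs]
  · have hBlim : Tendsto (fun j => B * δ j) atTop (𝓝 0) := by simpa using hδlim.const_mul B
    obtain ⟨j, hj1, hj2⟩ := ((hBlim.eventually (gt_mem_nhds hε)).and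
      (hlim.eventually (gt_mem_nhds (lt_add_of_pos_right _ hε)))).exists
    obtain ⟨u, x, hu, hx, hx1, hLi, hLe⟩ := exists_ordinary_control (f := f) (g := g) (L := L)
      (x₀ := x₀) (z := z j) hS (hVi j) (hVc j) (hVlow j) (hV1 j) hwI
      (intervalIntegrable_controlled_field hf.continuous (fun i => (hg i).continuous) hS
        (hVi j 0 S) hw (hzc j)) (hzeq j) (by simpa only [hcost] using hint j)
    refine ⟨u, x, _, hu, hx, ?_, hasEndpointCost_ordinaryCurve hu hx hLi, ?_⟩
    · rw [hx1]
      exact (hzy j S (right_mem_Icc.2 hS)).trans hj1.le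
    · rw [hLe]
      simp only [hcost]
      exact hj2.le

/-- Continuity of the auxiliary Lagrangian excludes a Lavrentiev gap. -/
theorem not_hasLavrentievGap (hf : LocallyLipschitz f) (hg : ∀ i, LocallyLipschitz (g i))
    (hL : Continuous fun p : E n × E k => L p.1 p.2)
    (H : ContinuousOn (fun p : E n × (ℝ × E k) => auxLagrangian L p.1 p.2.1 p.2.2)
      (univ ×ˢ halfBall k)) (x₀ x₁ : E n) :
    ¬ HasLavrentievGap f g L x₀ x₁ := by
  rw [HasLavrentievGap, not_lt]
  have hanti : Antitone (ordinaryInf f g L x₀ x₁) := fun a b hab =>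
    sInf_le_sInf fun r ⟨u, hu, x, hx, hle, hr⟩ => ⟨u, hu, x, hx, hle.trans hab, hr⟩
  rw [(hanti.tendsto_nhdsGT 0).limUnder_eq]
  refine sSup_le ?_
  rintro _ ⟨ε, hε, rfl⟩
  have hε : 0 < ε := hε
  refine le_sInf ?_
  rintro _ ⟨c, -, γ, hγ, -, y, hy, rfl, rfl⟩
  obtain ⟨C, hC, happ⟩ := exists_ordinary_approximation hf hg hL H hγ hy
  rw [hC]
  refine le_of_forall_gt_imp_ge_of_dense fun a ha => ?_
  obtain ⟨q, hq1, hq2⟩ := EReal.lt_iff_exists_real_btwn.1 ha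
  have hq1 : C < q := EReal.coe_lt_coe_iff.1 hq1
  obtain ⟨u, x, r, hu, hx, hxe, hcost, hr⟩ := happ (min ε (q - C)) (lt_min hε (sub_pos.2 hq1))
  have hle : ordinaryInf f g L x₀ (y (exitParam γ 1)) ε ≤ r :=
    sInf_le ⟨u, hu, x, hx, hxe.trans (min_le_left _ _), hcost⟩
  refine hle.trans (le_trans ?_ hq2.le)
  exact EReal.coe_le_coe_iff.2 (by linarith [min_le_right ε (q - C)])

/-- A continuous Lagrangian that is, up to a function of the state, positively homogeneous of degree
one in the control has a continuous auxiliary Lagrangian: it is `L₁(y) v + L₂(y, w)`, also at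
`v = 0`. -/
lemma continuousOn_auxLagrangian_of_homogeneous
    (hL : Continuous fun p : E n × E k => L p.1 p.2) {L₁ : E n → ℝ} {L₂ : E n → E k → ℝ}
    (hsum : ∀ x u, L x u = L₁ x + L₂ x u)
    (hhom : ∀ x u (s : ℝ), 0 < s → L₂ x (s • u) = s * L₂ x u) :
    ContinuousOn (fun p : E n × (ℝ × E k) => auxLagrangian L p.1 p.2.1 p.2.2)
      (univ ×ˢ halfBall k) := by
  have h0 : ∀ x, L₂ x 0 = 0 := fun x => by
    have := hhom x 0 2 two_pos
    rw [smul_zero] at this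
    linarith
  have hL1 : Continuous L₁ := by
    have : L₁ = fun x => L x 0 := funext fun x => by rw [hsum, h0, add_zero]
    rw [this]
    exact hL.comp (Continuous.prodMk_left 0)
  have hL2 : Continuous fun p : E n × E k => L₂ p.1 p.2 := by
    have : (fun p : E n × E k => L₂ p.1 p.2) = fun p => L p.1 p.2 - L₁ p.1 :=
      funext fun p => by rw [hsum, add_sub_cancel_left]
    rw [this]
    exact hL.sub (hL1.comp continuous_fst)
  have hpos : ∀ y (v : ℝ) w, 0 < v → L y (v⁻¹ • w) * v = L₁ y * v + L₂ y w := fun y v w hv => by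
    rw [hsum, hhom _ _ _ (inv_pos.2 hv), add_mul]
    field_simp
  have hcont : Continuous fun p : E n × (ℝ × E k) =>
      ((L₁ p.1 * p.2.1 + L₂ p.1 p.2.2 : ℝ) : EReal) := by
    refine continuous_coe_real_ereal.comp ?_
    exact ((hL1.comp continuous_fst).mul (continuous_fst.comp continuous_snd)).add
      (hL2.comp (continuous_fst.prodMk (continuous_snd.comp continuous_snd)))
  refine hcont.continuousOn.congr ?_
  rintro ⟨y, v, w⟩ ⟨-, hv, -⟩
  rcases (show 0 ≤ v from hv).eq_or_lt with rfl | hv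
  · refine auxLagrangian_zero_eq ?_
    have h1 : Tendsto (fun η : ℝ => L₁ y * η + L₂ y w) (𝓝[>] 0) (𝓝 (L₁ y * 0 + L₂ y w)) :=
      (((continuous_const_mul (L₁ y)).add continuous_const).tendsto 0).mono_left
        nhdsWithin_le_nhds
    refine h1.congr' ?_
    filter_upwards [self_mem_nhdsWithin] with η hη using (hpos y η w hη).symm
  · simp only [auxLagrangian_pos hv, hpos y v w hv]

end Approximation

end LagrangeGap

theorem mainTheorem6 {n k : ℕ}
    (f : LagrangeGap.E n → LagrangeGap.E n) (g : Fin k → LagrangeGap.E n → LagrangeGap.E n)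
    (L : LagrangeGap.E n → LagrangeGap.E k → ℝ) (x₀ x₁ : LagrangeGap.E n)
    (hf : LocallyLipschitz f) (hg : ∀ i, LocallyLipschitz (g i))
    (hL : Continuous fun p : LagrangeGap.E n × LagrangeGap.E k => L p.1 p.2)
    (hconv : ∀ x, ConvexOn ℝ Set.univ (L x)) :
    (ContinuousOn
        (fun p : LagrangeGap.E n × (ℝ × LagrangeGap.E k) =>
          LagrangeGap.auxLagrangian L p.1 p.2.1 p.2.2)
        (Set.univ ×ˢ LagrangeGap.halfBall k) →
      ¬ LagrangeGap.HasLavrentievGap f g L x₀ x₁) ∧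
    ((∃ (L₁ : LagrangeGap.E n → ℝ) (L₂ : LagrangeGap.E n → LagrangeGap.E k → ℝ),
        (∀ x u, L x u = L₁ x + L₂ x u) ∧
        (∀ x u (s : ℝ), 0 < s → L₂ x (s • u) = s * L₂ x u)) →
      ¬ LagrangeGap.HasLavrentievGap f g L x₀ x₁) := by
  refine ⟨fun H => LagrangeGap.not_hasLavrentievGap hf hg hL H x₀ x₁, ?_⟩
  rintro ⟨L₁, L₂, hsum, hhom⟩
  exact LagrangeGap.not_hasLavrentievGap hf hg hL
    (LagrangeGap.continuousOn_auxLagrangian_of_homogeneous hL hsum hhom) x₀ x₁
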